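/- Let $K \ge 1$, let $\pi$ be a probability mass function on $[K]$ with $\pi_a > 0$ for all $a$, let $\kappa = (\kappa_{a,b})_{a,b\in[K]}$ satisfy $\kappa_{a,b} > 0$ for all $a,b$, and let $\mathbf{m} = (m_1,\dots,m_K)$ be a vector of positive integers. The model $\mathscr{P}(\pi,\kappa,\mathbf{m})$ is the following random sequence of growing multigraphs $(\mathcal{G}_n)_{n\ge 0}$. The base graph $\mathcal{G}_0$ is a fixed finite connected (multi)graph, each vertex of which has an attribute in $[K]$. Given $\mathcal{G}_0,\dots,\mathcal{G}_n$, a new vertex $v_{n+1}$ enters; its attribute $a(v_{n+1})$ has law $\pi$, independently of the past. Given also $a(v_{n+1}) = b$, the vertex sends $m_b$ edges, which independently choose their targets among the vertices of $\mathcal{G}_n$, each choosing the vertex $v$ with probability $$\frac{\kappa_{a(v),b}\,\deg(v,n)}{\sum_{v'\in\mathcal{G}_n}\kappa_{a(v'),b}\,\deg(v',n)}.$$ Here $\deg(v,n)$ is the degree of $v$ in $\mathcal{G}_n$, counted with multiplicity (if $\mathcal{G}_0$ is a single vertex $v_0$ without edges, $\deg(v_0,0)$ is initialized to be $1$, and each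 edge later attached to $v_0$ increases its degree by one). The function $$V(\mathbf{y}) = \sum_{i=1}^K y_i - \frac12\sum_{j=1}^K m_j\pi_j\Big(\log y_j + \log\Big(\sum_{k=1}^K y_k\kappa_{k,j}\Big)\Big)$$ has a unique minimizer $\eta = (\eta_1,\dots,\eta_K)$ over $(0,\infty)^K$. For $a \in [K]$ put $$\phi^{\mathbf m}_a = \sum_{b=1}^K \kappa_{a,b}\,m_b\,\frac{\pi_b}{\sum_{l=1}^K\kappa_{l,b}\eta_l} > 0 .$$ Let $\mathbf{p}_n^{a}(k)$ be the proportion of vertices of degree $k$ among the vertices of $\mathcal{G}_n$ with attribute $a$. **Theorem.** For each $a\in[K]$, almost surely, $\mathbf{p}_n^{a}(k) \to \mathbf{p}_\infty^{a}(k)$ as $n\to\infty$ for all $k \ge m_a$, where $$\mathbf{p}_\infty^{a}(k) = \frac{2}{\phi^{\mathbf m}_a}\,\frac{\Gamma\big(m_a+\frac{2}{\phi^{\mathbf m}_a}\big)\,\Gamma(k)}{\Gamma\big(k+1+\frac{2}{\phi^{\mathbf m}_a}\big)\,\Gamma(m_a)},\qquad k\ge m_a,$$ and $\mathbf{p}_\infty^{a}$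 is a probability mass function on $\{m_a, m_a+1, \dots\}$. In particular $\mathbf{p}_\infty^{a}$ has a power-law tail with exponent $1+2/\phi^{\mathbf m}_a$: $$\mathbf{p}_\infty^{a}(k) \sim \frac{2}{\phi^{\mathbf m}_a}\,\frac{\Gamma\big(m_a+\frac{2}{\phi^{\mathbf m}_a}\big)}{\Gamma(m_a)}\;k^{-(1+2/\phi^{\mathbf m}_a)}\qquad (k\to\infty).$$ -/

import Mathlib

open Filter Topology Asymptotics MeasureTheory

namespace AttributedPA

/-- A finite attributed directed multigraph, with vertices `0, …, size - 1` (in order of arrival),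
attributes in `Fin K`, and a multiset of directed edges `(source, target)`; a later vertex is
the source of its edges. The orientation of the edges of the base graph plays no role. -/
@[ext]
structure Network (K : ℕ) where
  size : ℕ
  attr : Fin size → Fin K
  edges : Multiset (Fin size × Fin size)

instance (K : ℕ) : MeasurableSpace (Network K) := ⊤

namespace Network

/-- Connectedness of the underlying undirected graph (in particular there is a vertex). -/
def Connected {K : ℕ} (G : Network K) : Prop :=
  (SimpleGraph.fromRel fun u v => (u, v) ∈ G.edges).Connected

/-- The degree of `v` in `G`, where `G` has been grown from the base graph `G₀`: the number of
edge ends at `v`, with multiplicity. If the base graph is a single vertex without edges, the degree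
of this vertex (number `0`) is initialized to be one. -/
def deg {K : ℕ} (G₀ G : Network K) (v : Fin G.size) : ℕ :=
  (G.edges.map Prod.fst).count v + (G.edges.map Prod.snd).count v +
    if G₀.size = 1 ∧ G₀.edges = 0 ∧ (v : ℕ) = 0 then 1 else 0

/-- The network obtained from `G` by adding a vertex with attribute `b` and with `r` outgoing
edges, the `i`-th one pointing to the vertex `t i` of `G`. -/
def attach {K : ℕ} (G : Network K) (b : Fin K) {r : ℕ} (t : Fin r → Fin G.size) : Network K where
  size := G.size + 1
  attr := Fin.snoc (α := fun _ => Fin K) G.attr b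
  edges := G.edges.map (Prod.map Fin.castSucc Fin.castSucc) +
    Finset.univ.val.map fun i => (Fin.last G.size, (t i).castSucc)

/-- The proportion of vertices of degree `k` among the vertices of attribute `a`. -/
noncomputable def degFraction {K : ℕ} (G₀ G : Network K) (a : Fin K) (k : ℕ) : ℝ :=
  ((Finset.univ.filter fun v => G.attr v = a ∧ deg G₀ G v = k).card : ℝ) /
    ((Finset.univ.filter fun v => G.attr v = a).card : ℝ)

end Network

/-- The probability that an edge of a new vertex of attribute `b` chooses the vertex `v` of `G`. -/
noncomputable def edgeProb {K : ℕ} (κ : Fin K → Fin K → ℝ) (G₀ G : Network K) (b : Fin K)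
    (v : Fin G.size) : ℝ :=
  κ (G.attr v) b * (Network.deg G₀ G v : ℝ) /
    ∑ w : Fin G.size, κ (G.attr w) b * (Network.deg G₀ G w : ℝ)

open Classical in
/-- The one-step transition probability from `G` to `H`: a new vertex draws its attribute `b` from
`π`, and then its `m b` edges independently choose their targets among the vertices of `G`. -/
noncomputable def stepProb {K : ℕ} (π : Fin K → ℝ) (κ : Fin K → Fin K → ℝ) (m : Fin K → ℕ)
    (G₀ G H : Network K) : ℝ :=
  ∑ b : Fin K, π b * ∑ t : Fin (m b) → Fin G.size,
    (∏ i, edgeProb κ G₀ G b (t i)) * if G.attach b t = H then 1 else 0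

/-- The process `G` is an attributed linear preferential attachment model with parameters
`π`, `κ`, `m` and base graph `G₀`: it is the Markov chain started from `G₀` with transition
probabilities `stepProb`. -/
structure IsNetworkProcess {K : ℕ} {Ω : Type*} [MeasurableSpace Ω] (P : Measure Ω)
    (π : Fin K → ℝ) (κ : Fin K → Fin K → ℝ) (m : Fin K → ℕ) (G₀ : Network K)
    (G : ℕ → Ω → Network K) : Prop where
  measurable : ∀ n, Measurable (G n)
  initial : ∀ᵐ ω ∂P, G 0 ω = G₀
  step : ∀ (n : ℕ) (g : ℕ → Network K),
    P {ω | ∀ i ≤ n + 1, G i ω = g i} =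
      P {ω | ∀ i ≤ n, G i ω = g i} * ENNReal.ofReal (stepProb π κ m G₀ (g n) (g (n + 1)))

/-- The potential `V` on the open positive orthant. -/
noncomputable def potential {K : ℕ} (π : Fin K → ℝ) (κ : Fin K → Fin K → ℝ) (m : Fin K → ℕ)
    (y : Fin K → ℝ) : ℝ :=
  ∑ i, y i - 1 / 2 * ∑ j, (m j : ℝ) * π j * (Real.log (y j) + Real.log (∑ k, y k * κ k j))

/-- `η` minimizes the potential over the positive orthant (at the boundary of the orthant the
potential is infinite, so that the boundary is left out). -/
def IsPotentialMinimizer {K : ℕ} (π : Fin K → ℝ) (κ : Fin K → Fin K → ℝ) (m : Fin K → ℕ)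
    (η : Fin K → ℝ) : Prop :=
  (∀ i, 0 < η i) ∧ ∀ y : Fin K → ℝ, (∀ i, 0 < y i) → potential π κ m η ≤ potential π κ m y

/-- `φ a = ∑ b, κ a b * m b * ν b`, where `ν b = π b / ∑ l, κ l b * η l`. -/
noncomputable def phi {K : ℕ} (π : Fin K → ℝ) (κ : Fin K → Fin K → ℝ) (m : Fin K → ℕ)
    (η : Fin K → ℝ) (a : Fin K) : ℝ :=
  ∑ b, κ a b * (m b : ℝ) * (π b / ∑ l, κ l b * η l)

/-- The limiting degree distribution for out-degree `r` and parameter `φ`, at `k ≥ r`. -/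
noncomputable def limitPMF (φ : ℝ) (r k : ℕ) : ℝ :=
  2 / φ * (Real.Gamma (r + 2 / φ) * Real.Gamma k) /
    (Real.Gamma (k + 1 + 2 / φ) * Real.Gamma r)

end AttributedPA

namespace AttributedPA

/-! The total degrees per attribute form a stochastic approximation whose mean motion descends the
convex potential, and the degree counts then obey linear rate equations.

Probability enters only through a law of large numbers (`ae_tendsto_average_step_sub_mean`): a
functional with bounded increments grows like the average of its conditional drifts. Applied to the
total degrees, the attribute counts and the degree counts, it leaves a deterministic problem on
almost every path.

Let `Y` be the vector of total degrees. Its drift is homogeneous of degree 0, and half of it at `y`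
equals `y a - y a * ∂ₐV(y)` (`mul_potentialGrad`). So the running averages of the half drifts move
by steps of order `1 / n` along a rescaled negative gradient of `V`. Convexity with an explicit
remainder (`potential_ge`) makes `V` a Lyapunov function, and `tendsto_of_degreeDrift` gives `Y / n
→ 2η`.

Consequently a vertex of attribute `a` and degree `d` gains edges at rate about `(φ / 2) * d / n`.
The count of degree `k` has inflow from degree `k - 1`, outflow to degree `k + 1`, and births at `k
= m a`; several edges hitting one vertex of low degree is a negligible event. Solving for the limits
by induction on `k` (`tendsto_degCount_div`) yields the recursion satisfied by the Gamma quotients.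
These telescope to total mass one, and Euler's limit for Gamma gives the tail. -/

theorem tendsto_zero_of_descent {u ε : ℕ → ℝ} (hu : ∀ᶠ n in atTop, 0 ≤ u n)
    (hε : Tendsto ε atTop (𝓝 0)) (hinc : ∀ᶠ n in atTop, u (n + 1) ≤ u n + ε n)
    (hdec : ∀ δ > 0, ∃ d > 0, ∀ᶠ n : ℕ in atTop,
      δ ≤ u n → u (n + 1) ≤ u n - d / ((n : ℝ) + 1)) :
    Tendsto u atTop (𝓝 0) := by
  rw [Metric.tendsto_atTop]
  intro δ hδ
  obtain ⟨d, hd, hdec⟩ := hdec (δ / 2) (by positivity)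
  have hεδ : ∀ᶠ n in atTop, ε n < δ / 2 := hε.eventually_lt_const (by positivity)
  obtain ⟨N, hN⟩ := eventually_atTop.1 ((hinc.and hdec).and (hεδ.and hu))
  -- Staying above `δ / 2` forever would cost `d` times a tail of the divergent harmonic series,
  -- contradicting nonnegativity.
  obtain ⟨n₁, hn₁, hlt⟩ : ∃ n ≥ N, u n < δ / 2 := by
    by_contra! hcon
    have hb : ∀ n, N ≤ n → u n + d * ∑ i ∈ Finset.range n, 1 / ((i : ℝ) + 1) ≤
        u N + d * ∑ i ∈ Finset.range N, 1 / ((i : ℝ) + 1) := by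
      intro n hn
      induction n, hn using Nat.le_induction with
      | base => rfl
      | succ n hn ih =>
        have := (hN n hn).1.2 (hcon n hn)
        rw [Finset.sum_range_succ, mul_add]
        have e : d * (1 / ((n : ℝ) + 1)) = d / ((n : ℝ) + 1) := by ring
        linarith
    have ht := (Real.tendsto_sum_range_one_div_nat_succ_atTop.const_mul_atTop hd)
    obtain ⟨n, hn, hNn⟩ := ((ht.eventually_gt_atTop
      (u N + d * ∑ i ∈ Finset.range N, 1 / ((i : ℝ) + 1))).and (eventually_ge_atTop N)).exists
    have := hb n hNn
    have := (hN n hNn).2.2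
    linarith
  -- No later step can cross `δ`: below `δ / 2` it adds less than `δ / 2`, and between `δ / 2` and
  -- `δ` it decreases. Hence `ε` need not be summable.
  have key : ∀ n, n₁ ≤ n → u n < δ := by
    intro n hn
    induction n, hn using Nat.le_induction with
    | base => linarith
    | succ n hn ih =>
      obtain ⟨⟨h1, h2⟩, h3, -⟩ := hN n (hn₁.trans hn)
      by_cases h : δ / 2 ≤ u n
      · have := h2 h
        have : 0 < d / ((n : ℝ) + 1) := by positivity
        linarith
      · linarith
  refine ⟨n₁, fun n hn => ?_⟩
  rw [Real.dist_eq, sub_zero, abs_of_nonneg (hN n (hn₁.trans hn)).2.2]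
  exact key n hn

/-! ### The potential: quantitative convexity, existence and uniqueness of the minimizer. -/

section Potential

variable {K : ℕ} (π : Fin K → ℝ) (κ : Fin K → Fin K → ℝ) (m : Fin K → ℕ)

/-- The rate at which a vertex of attribute `a` gains degree, when the total degrees of the
attributes are proportional to `y`. -/
noncomputable def attachRate (y : Fin K → ℝ) (a : Fin K) : ℝ :=
  ∑ b, (m b : ℝ) * π b * κ a b / ∑ l, y l * κ l b

/-- The expected increment of the total degree of attribute `a`. -/
noncomputable def degreeDrift (y : Fin K → ℝ) (a : Fin K) : ℝ :=
  (m a : ℝ) * π a + y a * attachRate π κ m y a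

/-- The partial derivatives of the potential. -/
noncomputable def potentialGrad (y : Fin K → ℝ) (a : Fin K) : ℝ :=
  1 - 1 / 2 * ((m a : ℝ) * π a / y a + attachRate π κ m y a)

theorem phi_eq_attachRate (y : Fin K → ℝ) (a : Fin K) :
    phi π κ m y a = attachRate π κ m y a := by
  unfold phi attachRate
  refine Finset.sum_congr rfl fun b _ => ?_
  rw [Finset.sum_congr rfl fun l _ => mul_comm (κ l b) (y l)]
  ring

variable {π κ m}

/-- Double `log t ≤ t - 1` at `t = √x`; the bound `2√x - 2` is exactly the right-hand side. The
square supplies the strictness of convexity in a quantitative form. -/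
theorem log_le_sub_one_sub_sq_sqrt {x : ℝ} (hx : 0 < x) :
    Real.log x ≤ x - 1 - (√x - 1) ^ 2 := by
  have h := Real.log_le_sub_one_of_pos (Real.sqrt_pos.2 hx)
  rw [Real.log_sqrt hx.le] at h
  nlinarith [Real.sq_sqrt hx.le]

theorem weighted_sum_pos (hκ : ∀ a b, 0 < κ a b) {y : Fin K → ℝ} (hy : ∀ i, 0 < y i)
    (j : Fin K) : 0 < ∑ k, y k * κ k j :=
  Finset.sum_pos (fun k _ => mul_pos (hy k) (hκ k j)) ⟨j, Finset.mem_univ j⟩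

/-- Tangent-plane inequality for `-log`, sharpened only in the terms `log (y j)`. It is used with
`y` the minimizer (uniqueness; small excess forces closeness), with `z` the minimizer (the excess is
controlled by the gradient), and with `y` the next iterate (one-step decrease). -/
theorem potential_ge (hπ : ∀ a, 0 ≤ π a) (hκ : ∀ a b, 0 < κ a b)
    {y z : Fin K → ℝ} (hy : ∀ i, 0 < y i) (hz : ∀ i, 0 < z i) :
    potential π κ m y + ∑ a, potentialGrad π κ m y a * (z a - y a) +
      1 / 2 * ∑ j, (m j : ℝ) * π j * (√(z j / y j) - 1) ^ 2 ≤ potential π κ m z := by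
  have hLy := weighted_sum_pos hκ hy
  have hLz := weighted_sum_pos hκ hz
  have hlog : ∀ j, (m j : ℝ) * π j * (Real.log (z j) + Real.log (∑ k, z k * κ k j)) ≤
      (m j : ℝ) * π j * (Real.log (y j) + Real.log (∑ k, y k * κ k j)) +
      (m j : ℝ) * π j * (z j / y j - 1) - (m j : ℝ) * π j * (√(z j / y j) - 1) ^ 2 +
      (m j : ℝ) * π j * ((∑ k, z k * κ k j) / (∑ k, y k * κ k j) - 1) := by
    intro j
    have h1 := log_le_sub_one_sub_sq_sqrt (div_pos (hz j) (hy j))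
    have h2 := Real.log_le_sub_one_of_pos (div_pos (hLz j) (hLy j))
    rw [Real.log_div (hz j).ne' (hy j).ne'] at h1
    rw [Real.log_div (hLz j).ne' (hLy j).ne'] at h2
    have h3 : 0 ≤ (m j : ℝ) * π j := mul_nonneg (Nat.cast_nonneg _) (hπ j)
    nlinarith [mul_le_mul_of_nonneg_left (add_le_add h1 h2) h3]
  have hgrad : ∑ a, potentialGrad π κ m y a * (z a - y a) = ∑ a, z a - ∑ a, y a -
      1 / 2 * (∑ j, (m j : ℝ) * π j * (z j / y j - 1) +
        ∑ j, (m j : ℝ) * π j * ((∑ k, z k * κ k j) / (∑ k, y k * κ k j) - 1)) := by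
    have hswap : ∑ j, (m j : ℝ) * π j * ((∑ k, z k * κ k j) / (∑ k, y k * κ k j) - 1) =
        ∑ a, attachRate π κ m y a * (z a - y a) := by
      simp only [attachRate, Finset.sum_mul]
      rw [Finset.sum_comm]
      refine Finset.sum_congr rfl fun j _ => ?_
      rw [div_sub_one (hLy j).ne', ← Finset.sum_sub_distrib, Finset.sum_div, Finset.mul_sum]
      refine Finset.sum_congr rfl fun k _ => ?_
      ring
    rw [hswap, ← Finset.sum_add_distrib, Finset.mul_sum, ← Finset.sum_sub_distrib,
      ← Finset.sum_sub_distrib]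
    refine Finset.sum_congr rfl fun a _ => ?_
    unfold potentialGrad
    have := (hy a).ne'
    field_simp
  have hsum := Finset.sum_le_sum fun j (_ : j ∈ Finset.univ) => hlog j
  simp only [Finset.sum_add_distrib, Finset.sum_sub_distrib] at hsum
  rw [hgrad]
  unfold potential
  linarith

theorem potential_continuousOn (hκ : ∀ a b, 0 < κ a b) :
    ContinuousOn (potential π κ m) {y | ∀ i, 0 < y i} := by
  unfold potential
  refine ContinuousOn.sub (by fun_prop) (ContinuousOn.mul continuousOn_const ?_)
  refine continuousOn_finsetSum _ fun j _ => ContinuousOn.mul continuousOn_const ?_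
  refine ContinuousOn.add ?_ ?_
  · exact ContinuousOn.log (by fun_prop) fun y hy => (hy j).ne'
  · exact ContinuousOn.log (by fun_prop) fun y hy => (weighted_sum_pos hκ hy j).ne'

theorem attachRate_continuousOn (hκ : ∀ a b, 0 < κ a b) :
    ContinuousOn (attachRate π κ m) {y | ∀ i, 0 < y i} := by
  unfold attachRate
  refine continuousOn_pi.2 fun a => continuousOn_finsetSum _ fun b _ => ?_
  exact ContinuousOn.div (by fun_prop) (by fun_prop) fun y hy => (weighted_sum_pos hκ hy b).ne'

theorem potentialGrad_continuousOn (hκ : ∀ a b, 0 < κ a b) :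
    ContinuousOn (potentialGrad π κ m) {y | ∀ i, 0 < y i} := by
  unfold potentialGrad
  refine continuousOn_pi.2 fun a => ?_
  refine continuousOn_const.sub (continuousOn_const.mul (ContinuousOn.add ?_ ?_))
  · exact ContinuousOn.div (by fun_prop) (by fun_prop) fun y hy => (hy a).ne'
  · exact continuousOn_pi.1 (attachRate_continuousOn hκ) a

/-- The potential dominates a separable coercive function. -/
theorem exists_separable_le_potential (hπ : ∀ a, 0 < π a) (hκ : ∀ a b, 0 < κ a b)
    (hm : ∀ a, 1 ≤ m a) :
    ∃ C : ℝ, ∀ y : Fin K → ℝ, (∀ i, 0 < y i) →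
      ∑ i, (1 / 2 * y i - 1 / 2 * ((m i : ℝ) * π i) * Real.log (y i)) - C ≤
        potential π κ m y := by
  have hc : ∀ j, 0 < (m j : ℝ) * π j := fun j =>
    mul_pos (by exact_mod_cast hm j) (hπ j)
  -- `T` dominates every row sum, so bounding each `log (∑ k, y k * κ k j)` linearly from its
  -- tangent at `T` costs at most `∑ k, y k` in all; after the factor 1/2, half of the linear term
  -- of the potential survives.
  set T : ℝ := 1 + ∑ i, ∑ j, (m j : ℝ) * π j * κ i j with hT
  have hTi : ∀ i, ∑ j, (m j : ℝ) * π j * κ i j ≤ T := by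
    intro i
    have := Finset.single_le_sum (f := fun i => ∑ j, (m j : ℝ) * π j * κ i j)
      (fun i _ => Finset.sum_nonneg fun j _ => (mul_pos (hc j) (hκ i j)).le) (Finset.mem_univ i)
    linarith
  have hT0 : 0 < T := by
    have : 0 ≤ ∑ i, ∑ j, (m j : ℝ) * π j * κ i j :=
      Finset.sum_nonneg fun i _ => Finset.sum_nonneg fun j _ => (mul_pos (hc j) (hκ i j)).le
    linarith
  refine ⟨1 / 2 * ∑ j, (m j : ℝ) * π j * Real.log T, fun y hy => ?_⟩
  have h1 : ∀ j, (m j : ℝ) * π j * (Real.log (y j) + Real.log (∑ k, y k * κ k j)) ≤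
      (m j : ℝ) * π j * Real.log (y j) + (m j : ℝ) * π j * Real.log T +
        (m j : ℝ) * π j * ((∑ k, y k * κ k j) / T) := by
    intro j
    have hL := weighted_sum_pos hκ hy j
    have h := Real.log_le_sub_one_of_pos (div_pos hL hT0)
    rw [Real.log_div hL.ne' hT0.ne'] at h
    nlinarith [hc j]
  have h2 : ∑ j, (m j : ℝ) * π j * ((∑ k, y k * κ k j) / T) ≤ ∑ k, y k := by
    have : ∑ j, (m j : ℝ) * π j * ((∑ k, y k * κ k j) / T) =
        ∑ k, y k * ((∑ j, (m j : ℝ) * π j * κ k j) / T) := by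
      simp only [Finset.sum_div, Finset.mul_sum]
      rw [Finset.sum_comm]
      refine Finset.sum_congr rfl fun k _ => Finset.sum_congr rfl fun j _ => ?_
      ring
    rw [this]
    refine Finset.sum_le_sum fun k _ => ?_
    exact mul_le_of_le_one_right (hy k).le ((div_le_one hT0).2 (hTi k))
  have hsum := Finset.sum_le_sum fun j (_ : j ∈ Finset.univ) => h1 j
  simp only [Finset.sum_add_distrib] at hsum
  have h3 : ∑ i, (1 / 2 * y i - 1 / 2 * ((m i : ℝ) * π i) * Real.log (y i)) =
      1 / 2 * ∑ i, y i - 1 / 2 * ∑ i, (m i : ℝ) * π i * Real.log (y i) := by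
    rw [Finset.sum_sub_distrib, Finset.mul_sum, Finset.mul_sum]
    simp only [mul_assoc]
  rw [h3]
  unfold potential
  linarith

theorem exists_isPotentialMinimizer (hπ : ∀ a, 0 < π a) (hκ : ∀ a b, 0 < κ a b)
    (hm : ∀ a, 1 ≤ m a) : ∃ η, IsPotentialMinimizer π κ m η := by
  have hc : ∀ j, 0 < (m j : ℝ) * π j := fun j =>
    mul_pos (by exact_mod_cast hm j) (hπ j)
  obtain ⟨C, hC⟩ := exists_separable_le_potential hπ hκ hm
  set g : Fin K → ℝ → ℝ := fun i t => 1 / 2 * t - 1 / 2 * ((m i : ℝ) * π i) * Real.log t with hg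
  -- each summand is bounded below
  have hgt : ∀ i, ∀ t, 0 < t → 1 / 4 * t - 1 / 2 * ((m i : ℝ) * π i) *
      |Real.log (2 * ((m i : ℝ) * π i))| ≤ g i t := by
    intro i t ht
    -- The tangent of `log` at `2 * (m i * π i)` consumes exactly half of the term `t / 2`.
    have hs : 0 < 2 * ((m i : ℝ) * π i) := by linarith [hc i]
    have h := Real.log_le_sub_one_of_pos (div_pos ht hs)
    rw [Real.log_div ht.ne' hs.ne'] at h
    have h' : Real.log t ≤ t / (2 * ((m i : ℝ) * π i)) + |Real.log (2 * ((m i : ℝ) * π i))| := by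
      linarith [le_abs_self (Real.log (2 * ((m i : ℝ) * π i)))]
    have h2 := mul_le_mul_of_nonneg_left h' (by linarith [hc i] : 0 ≤ 1 / 2 * ((m i : ℝ) * π i))
    have e : 1 / 2 * ((m i : ℝ) * π i) * (t / (2 * ((m i : ℝ) * π i))) = 1 / 4 * t := by
      have hcancel : ∀ c : ℝ, c ≠ 0 → 1 / 2 * c * (t / (2 * c)) = 1 / 4 * t := by
        intro c hc
        field_simp
        norm_num
      exact hcancel _ (hc i).ne'
    rw [mul_add, e] at h2
    simp only [hg]
    linarith
  set B : Fin K → ℝ := fun i => 1 / 2 * ((m i : ℝ) * π i) *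
      |Real.log (2 * ((m i : ℝ) * π i))| with hB
  have hB0 : ∀ i, 0 ≤ B i := fun i =>
    mul_nonneg (by linarith [hc i]) (abs_nonneg _)
  -- The point `(1, …, 1)` fixes a nonempty sublevel set. As the other summands are bounded below,
  -- each `g i (y i)` is bounded on it, which confines `y i` to `[exp (-S), R]`; the `+ 1` in `R`
  -- keeps the reference point inside this box.
  set V₁ := potential π κ m fun _ => 1
  set A : ℝ := |V₁| + |C| + ∑ i, B i with hA
  have hA0 : 0 ≤ A := by
    have := Finset.sum_nonneg fun i (_ : i ∈ Finset.univ) => hB0 i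
    positivity
  have hterm : ∀ y : Fin K → ℝ, (∀ i, 0 < y i) → potential π κ m y ≤ V₁ → ∀ i, g i (y i) ≤ A := by
    intro y hy hV i
    have h1 := hC y hy
    have h2 : g i (y i) + B i ≤ ∑ i, (g i (y i) + B i) :=
      Finset.single_le_sum (f := fun i => g i (y i) + B i)
        (fun i _ => by have := hgt i (y i) (hy i); have := hy i; simp only [hB]; linarith)
        (Finset.mem_univ i)
    rw [Finset.sum_add_distrib] at h2
    have := hB0 i
    linarith [le_abs_self V₁, le_abs_self C]
  set R : ℝ := 4 * (A + ∑ i, B i) + 1 with hR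
  have hBs : ∀ i, B i ≤ ∑ i, B i := fun i =>
    Finset.single_le_sum (f := B) (fun i _ => hB0 i) (Finset.mem_univ i)
  have hupper : ∀ y : Fin K → ℝ, (∀ i, 0 < y i) → potential π κ m y ≤ V₁ → ∀ i, y i ≤ R := by
    intro y hy hV i
    have h1 := hterm y hy hV i
    have h2 := hgt i (y i) (hy i)
    have h3 := hBs i
    simp only [hB] at h3
    linarith
  set S : ℝ := ∑ i, 2 * A / ((m i : ℝ) * π i) with hS
  have hSi : ∀ i, 2 * A / ((m i : ℝ) * π i) ≤ S := fun i =>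
    Finset.single_le_sum (f := fun i => 2 * A / ((m i : ℝ) * π i))
      (fun i _ => div_nonneg (by linarith) (hc i).le) (Finset.mem_univ i)
  have hlower : ∀ y : Fin K → ℝ, (∀ i, 0 < y i) → potential π κ m y ≤ V₁ →
      ∀ i, Real.exp (-S) ≤ y i := by
    intro y hy hV i
    have h1 := hterm y hy hV i
    have h2 : -(2 * A / ((m i : ℝ) * π i)) ≤ Real.log (y i) := by
      simp only [hg] at h1
      have h3 : -(2 * A) ≤ Real.log (y i) * ((m i : ℝ) * π i) := by
        nlinarith [hy i]
      rw [← neg_div, div_le_iff₀ (hc i)]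
      exact h3
    rw [← Real.le_log_iff_exp_le (hy i)]
    linarith [hSi i]
  have hS0 : 0 ≤ S := Finset.sum_nonneg fun i _ => div_nonneg (by linarith) (hc i).le
  have hR1 : 1 ≤ R := by
    have := Finset.sum_nonneg fun i (_ : i ∈ Finset.univ) => hB0 i
    linarith
  have hcomp : IsCompact (Set.pi Set.univ fun _ : Fin K => Set.Icc (Real.exp (-S)) R) :=
    isCompact_univ_pi fun _ => isCompact_Icc
  have h1mem : (fun _ => 1) ∈ Set.pi Set.univ fun _ : Fin K => Set.Icc (Real.exp (-S)) R :=
    fun i _ => ⟨Real.exp_le_one_iff.2 (by linarith), hR1⟩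
  have hcont : ContinuousOn (potential π κ m)
      (Set.pi Set.univ fun _ : Fin K => Set.Icc (Real.exp (-S)) R) :=
    (potential_continuousOn hκ).mono fun y hy i =>
      (Real.exp_pos _).trans_le (hy i (Set.mem_univ i)).1
  obtain ⟨η, hηm, hη⟩ := hcomp.exists_isMinOn ⟨_, h1mem⟩ hcont
  refine ⟨η, fun i => (Real.exp_pos _).trans_le (hηm i (Set.mem_univ i)).1, fun y hy => ?_⟩
  by_cases hV : potential π κ m y ≤ V₁
  · exact hη fun i _ => ⟨hlower y hy hV i, hupper y hy hV i⟩
  · exact (hη h1mem).trans (not_le.1 hV).le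

theorem potentialGrad_eq_zero (hκ : ∀ a b, 0 < κ a b)
    {η : Fin K → ℝ} (hη : IsPotentialMinimizer π κ m η) (a : Fin K) :
    potentialGrad π κ m η a = 0 := by
  obtain ⟨hpos, hmin⟩ := hη
  set γ : ℝ → Fin K → ℝ := fun t => Function.update η a (η a + t) with hγ
  have hγ0 : γ 0 = η := by simp [hγ]
  have hγd : ∀ i, HasDerivAt (fun t => γ t i) (if i = a then 1 else 0) 0 := by
    intro i
    by_cases h : i = a
    · subst h
      simpa [hγ] using (hasDerivAt_id (0 : ℝ)).const_add (η i)
    · simpa [hγ, h, Function.update_of_ne h] using hasDerivAt_const (0 : ℝ) (η i)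
  have hd : HasDerivAt (fun t => potential π κ m (γ t))
      (∑ i, (if i = a then 1 else 0) - 1 / 2 * ∑ j, (m j : ℝ) * π j *
        ((if j = a then 1 else 0) / γ 0 j +
          (∑ k, (if k = a then 1 else 0) * κ k j) / ∑ k, γ 0 k * κ k j)) 0 := by
    unfold potential
    refine HasDerivAt.sub (HasDerivAt.fun_sum fun i _ => hγd i) (HasDerivAt.const_mul _ ?_)
    refine HasDerivAt.fun_sum fun j _ => HasDerivAt.const_mul _ (HasDerivAt.add ?_ ?_)
    · exact (hγd j).log (by rw [hγ0]; exact (hpos j).ne')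
    · exact (HasDerivAt.fun_sum fun k _ => (hγd k).mul_const _).log
        (by rw [hγ0]; exact (weighted_sum_pos hκ hpos j).ne')
  have hloc : IsLocalMin (fun t => potential π κ m (γ t)) 0 := by
    filter_upwards [Ioi_mem_nhds (neg_lt_zero.2 (hpos a))] with t ht
    rw [hγ0]
    refine hmin _ fun i => ?_
    by_cases h : i = a
    · subst h
      simp only [hγ, Function.update_self]
      linarith [Set.mem_Ioi.1 ht]
    · simpa [hγ, h] using hpos i
  have := hloc.hasDerivAt_eq_zero hd
  rw [hγ0] at this
  rw [← this]
  unfold potentialGrad attachRate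
  simp [mul_add, Finset.sum_add_distrib, ← mul_div_assoc, ite_div]
  ring

/-- The gradient vanishes at `η`, so equality of the two minimal values forces the weighted squares
in `potential_ge` to vanish. -/
theorem IsPotentialMinimizer.unique (hπ : ∀ a, 0 < π a) (hκ : ∀ a b, 0 < κ a b)
    (hm : ∀ a, 1 ≤ m a) {η η' : Fin K → ℝ} (hη : IsPotentialMinimizer π κ m η)
    (hη' : IsPotentialMinimizer π κ m η') : η' = η := by
  have h := potential_ge (m := m) (fun a => (hπ a).le) hκ hη.1 hη'.1
  simp only [potentialGrad_eq_zero hκ hη, zero_mul, Finset.sum_const_zero] at h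
  have h' := hη'.2 η hη.1
  have hnn : ∀ j ∈ Finset.univ, 0 ≤ (m j : ℝ) * π j * (√(η' j / η j) - 1) ^ 2 := fun j _ =>
    mul_nonneg (mul_nonneg (Nat.cast_nonneg _) (hπ j).le) (sq_nonneg _)
  have h0 : ∑ j, (m j : ℝ) * π j * (√(η' j / η j) - 1) ^ 2 = 0 :=
    le_antisymm (by linarith) (Finset.sum_nonneg hnn)
  funext j
  have hj := (Finset.sum_eq_zero_iff_of_nonneg hnn).1 h0 j (Finset.mem_univ j)
  have hc : (m j : ℝ) * π j ≠ 0 :=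
    (mul_pos (by exact_mod_cast hm j) (hπ j)).ne'
  have hs : √(η' j / η j) = 1 := by
    have := pow_eq_zero_iff (two_ne_zero) |>.1 ((mul_eq_zero.1 hj).resolve_left hc)
    linarith
  rw [Real.sqrt_eq_one, div_eq_one_iff_eq (hη.1 j).ne'] at hs
  exact hs

end Potential

/-! ### Deterministic recursions for running averages. -/

theorem average_succ (f : ℕ → ℝ) (n : ℕ) :
    (∑ i ∈ Finset.range (n + 1), f i) / ((n + 1 : ℕ) : ℝ) = (∑ i ∈ Finset.range n, f i) / n +
      (f n - (∑ i ∈ Finset.range n, f i) / n) / ((n : ℝ) + 1) := by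
  rw [Finset.sum_range_succ]
  -- At `n = 0` the empty average is `0 / 0 = 0`, and the identity still holds.
  rcases n.eq_zero_or_pos with rfl | hn
  · simp
  · have : (n : ℝ) ≠ 0 := by positivity
    have : (n : ℝ) + 1 ≠ 0 := by positivity
    push_cast
    field_simp
    ring

theorem tendsto_mul_zero_of_bounded {x y : ℕ → ℝ} {C : ℝ} (hx : ∀ᶠ n in atTop, |x n| ≤ C)
    (hy : Tendsto y atTop (𝓝 0)) : Tendsto (fun n => x n * y n) atTop (𝓝 0) := by
  have h : Tendsto (fun n => C * |y n|) atTop (𝓝 0) := by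
    simpa using (hy.abs).const_mul C
  refine squeeze_zero_norm' ?_ h
  filter_upwards [hx] with n hn
  rw [Real.norm_eq_abs, abs_mul]
  exact mul_le_mul_of_nonneg_right hn (abs_nonneg _)

/-- If the averages of `f` follow `x n / n`, and `f n` is asymptotically `b - c * (x n / n)`, then
`x n / n` tends to the solution `z` of `z = b - c * z`. -/
theorem tendsto_of_linear_recursion {f x : ℕ → ℝ} {b c : ℝ} (hc : 0 ≤ c)
    (hx : Tendsto (fun n : ℕ => x n / n - (∑ i ∈ Finset.range n, f i) / n) atTop (𝓝 0))
    (hf : Tendsto (fun n : ℕ => f n + c * (x n / n)) atTop (𝓝 b)) :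
    Tendsto (fun n : ℕ => x n / n) atTop (𝓝 (b / (1 + c))) := by
  -- The averages satisfy an exact recursion, whereas `x n / n` satisfies it only asymptotically;
  -- the two differ by a null sequence.
  set z : ℕ → ℝ := fun n => (∑ i ∈ Finset.range n, f i) / n with hz
  set e : ℕ → ℝ := fun n => z n - b / (1 + c) with he
  have hc1 : 1 + c ≠ 0 := by positivity
  set g : ℕ → ℝ := fun n => f n + c * z n - b with hg
  have hg0 : Tendsto g atTop (𝓝 0) := by
    have := (hf.sub (hx.const_mul c)).sub_const b
    simp only [mul_zero, sub_zero, sub_self] at this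
    refine this.congr fun n => ?_
    simp only [hg, hz]
    ring
  have hrec : ∀ n : ℕ, e (n + 1) = e n * (1 - (1 + c) / ((n : ℝ) + 1)) + g n / ((n : ℝ) + 1) := by
    intro n
    have h1 : z (n + 1) = z n + (f n - z n) / ((n : ℝ) + 1) := average_succ f n
    have : (n : ℝ) + 1 ≠ 0 := by positivity
    simp only [he, hg]
    rw [h1]
    field_simp
    ring
  have hbound : ∀ᶠ n : ℕ in atTop,
      |e (n + 1)| ≤ |e n| - (1 + c) * |e n| / ((n : ℝ) + 1) + |g n| / ((n : ℝ) + 1) := by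
    -- From `n ≥ c` on, the factor `1 - (1 + c) / (n + 1)` is nonnegative, so absolute values
    -- contract.
    filter_upwards [(tendsto_natCast_atTop_atTop (R := ℝ)).eventually_ge_atTop c] with n hn
    have hn1 : (0 : ℝ) < (n : ℝ) + 1 := by positivity
    have h2 : 0 ≤ 1 - (1 + c) / ((n : ℝ) + 1) := by
      rw [sub_nonneg, div_le_one hn1]
      linarith
    rw [hrec n]
    refine (abs_add_le _ _).trans (le_of_eq ?_)
    rw [abs_mul, abs_of_nonneg h2, abs_div, abs_of_pos hn1]
    ring
  have hlim : Tendsto (fun n => |e n|) atTop (𝓝 0) := by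
    refine tendsto_zero_of_descent (ε := fun n => |g n|) (Eventually.of_forall fun n => abs_nonneg _)
      (by simpa using hg0.abs) ?_ ?_
    · filter_upwards [hbound] with n hn
      have h1 : 0 ≤ (1 + c) * |e n| / ((n : ℝ) + 1) := by positivity
      have h2 : |g n| / ((n : ℝ) + 1) ≤ |g n| :=
        div_le_self (abs_nonneg _) (by linarith [(Nat.cast_nonneg n : (0 : ℝ) ≤ n)])
      linarith
    · intro δ hδ
      refine ⟨δ / 2, by positivity, ?_⟩
      have hgs : ∀ᶠ n in atTop, |g n| < δ / 2 :=
        (by simpa using hg0.abs : Tendsto (fun n => |g n|) atTop (𝓝 0)).eventually_lt_const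
          (by positivity)
      filter_upwards [hbound, hgs] with n hn hgn hδn
      have hn1 : (0 : ℝ) < (n : ℝ) + 1 := by positivity
      have h1 : |g n| / ((n : ℝ) + 1) ≤ (δ / 2) / ((n : ℝ) + 1) := by gcongr
      have h2 : δ / ((n : ℝ) + 1) ≤ (1 + c) * |e n| / ((n : ℝ) + 1) := by
        gcongr
        nlinarith [abs_nonneg (e n)]
      have h3 : δ / ((n : ℝ) + 1) = (δ / 2) / ((n : ℝ) + 1) + (δ / 2) / ((n : ℝ) + 1) := by ring
      linarith
  have hz' : Tendsto z atTop (𝓝 (b / (1 + c))) := by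
    have := (tendsto_zero_iff_abs_tendsto_zero e).2 hlim
    have := this.add_const (b / (1 + c))
    simp only [zero_add] at this
    exact this.congr fun n => by simp [he]
  simpa [hz] using hx.add hz'

/-- Uniform continuity serves here because neither sequence is known to converge. -/
theorem UniformContinuousOn.tendsto_sub {E F : Type*} [NormedAddCommGroup E]
    [NormedAddCommGroup F] {f : E → F} {s : Set E} (hf : UniformContinuousOn f s)
    {x y : ℕ → E} (hx : ∀ᶠ n in atTop, x n ∈ s) (hy : ∀ᶠ n in atTop, y n ∈ s)
    (hxy : Tendsto (fun n => x n - y n) atTop (𝓝 0)) :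
    Tendsto (fun n => f (x n) - f (y n)) atTop (𝓝 0) := by
  rw [Metric.tendsto_atTop]
  intro ε hε
  obtain ⟨δ, hδ, h⟩ := Metric.uniformContinuousOn_iff.1 hf ε hε
  have h1 : ∀ᶠ n in atTop, dist (x n - y n) 0 < δ := Metric.tendsto_nhds.1 hxy δ hδ
  obtain ⟨N, hN⟩ := eventually_atTop.1 ((hx.and hy).and h1)
  refine ⟨N, fun n hn => ?_⟩
  obtain ⟨⟨hx, hy⟩, hd⟩ := hN n hn
  rw [dist_zero_right, ← dist_eq_norm] at hd ⊢
  exact h _ hx _ hy hd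

/-! ### Convergence of the normalised total degrees. -/

section Dynamics

variable {K : ℕ} {π : Fin K → ℝ} {κ : Fin K → Fin K → ℝ} {m : Fin K → ℕ}

theorem attachRate_nonneg (hπ : ∀ a, 0 < π a) (hκ : ∀ a b, 0 < κ a b) {y : Fin K → ℝ}
    (hy : ∀ a, 0 ≤ y a) (a : Fin K) : 0 ≤ attachRate π κ m y a :=
  Finset.sum_nonneg fun b _ => div_nonneg
    (mul_nonneg (mul_nonneg (Nat.cast_nonneg _) (hπ b).le) (hκ a b).le)
    (Finset.sum_nonneg fun l _ => mul_nonneg (hy l) (hκ l b).le)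

theorem mul_attachRate_le (hπ : ∀ a, 0 < π a) (hκ : ∀ a b, 0 < κ a b) {y : Fin K → ℝ}
    (hy : ∀ a, 0 ≤ y a) (a : Fin K) :
    y a * attachRate π κ m y a ≤ ∑ b, (m b : ℝ) * π b := by
  unfold attachRate
  rw [Finset.mul_sum]
  refine Finset.sum_le_sum fun b _ => ?_
  have h1 : y a * κ a b ≤ ∑ l, y l * κ l b :=
    Finset.single_le_sum (f := fun l => y l * κ l b)
      (fun l _ => mul_nonneg (hy l) (hκ l b).le) (Finset.mem_univ a)
  have h2 : y a * κ a b / ∑ l, y l * κ l b ≤ 1 :=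
    div_le_one_of_le₀ h1 (Finset.sum_nonneg fun l _ => mul_nonneg (hy l) (hκ l b).le)
  calc y a * ((m b : ℝ) * π b * κ a b / ∑ l, y l * κ l b)
      = (m b : ℝ) * π b * (y a * κ a b / ∑ l, y l * κ l b) := by ring
    _ ≤ (m b : ℝ) * π b :=
      mul_le_of_le_one_right (mul_nonneg (Nat.cast_nonneg _) (hπ b).le) h2

theorem attachRate_div (r : ℝ) (y : Fin K → ℝ) (a : Fin K) :
    attachRate π κ m (fun i => y i / r) a = r * attachRate π κ m y a := by
  unfold attachRate
  rw [Finset.mul_sum]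
  refine Finset.sum_congr rfl fun b _ => ?_
  have : ∑ l, y l / r * κ l b = (∑ l, y l * κ l b) / r := by
    rw [Finset.sum_div]
    exact Finset.sum_congr rfl fun l _ => by ring
  rw [this, div_div_eq_mul_div]
  ring

/-- The rate has homogeneity -1, so `y a` times the rate is scale invariant; the drift sees only the
proportions of the total degrees. -/
theorem degreeDrift_div {r : ℝ} (hr : r ≠ 0) (y : Fin K → ℝ) (a : Fin K) :
    degreeDrift π κ m (fun i => y i / r) a = degreeDrift π κ m y a := by
  unfold degreeDrift
  rw [attachRate_div]
  field_simp

/-- The link between the process and `V`: the mean motion, half drift minus position, is the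
negative gradient with positive mobility `y a`. -/
theorem mul_potentialGrad {y : Fin K → ℝ} {a : Fin K} (hy : y a ≠ 0) :
    y a * potentialGrad π κ m y a = y a - degreeDrift π κ m y a / 2 := by
  unfold potentialGrad degreeDrift
  field_simp

/-- Cauchy–Schwarz turns a first-order gap into a lower bound for the dissipation of `V`. The
denominator `K + 1` instead of `K` is positive without a case distinction. -/
theorem le_sum_mul_sq_of_le_sum_abs {lo B δ : ℝ} (hlo : 0 < lo) (hB : 0 < B) (hδ : 0 < δ)
    {y g : Fin K → ℝ} (hy : ∀ a, lo ≤ y a) (h : δ ≤ ∑ a, |g a| * B) :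
    lo * (δ / B) ^ 2 / (K + 1) ≤ ∑ a, y a * g a ^ 2 := by
  have h1 : δ / B ≤ ∑ a, |g a| := by
    rw [div_le_iff₀ hB, Finset.sum_mul]
    exact h
  have h2 : (∑ a, |g a|) ^ 2 ≤ K * ∑ a, g a ^ 2 := by
    have := sq_sum_le_card_mul_sum_sq (s := Finset.univ) (f := fun a => |g a|)
    simpa using this
  have h3 : (δ / B) ^ 2 ≤ (∑ a, |g a|) ^ 2 := by
    gcongr
  have h4 : lo * ∑ a, g a ^ 2 ≤ ∑ a, y a * g a ^ 2 := by
    rw [Finset.mul_sum]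
    exact Finset.sum_le_sum fun a _ => mul_le_mul_of_nonneg_right (hy a) (sq_nonneg _)
  refine le_trans ?_ h4
  rw [div_le_iff₀ (by positivity), mul_assoc]
  refine mul_le_mul_of_nonneg_left ?_ hlo.le
  have h5 : 0 ≤ ∑ a, g a ^ 2 := Finset.sum_nonneg fun a _ => sq_nonneg _
  nlinarith

/-- Lyapunov argument for the averages `z` of the half drifts, which shadow `Y n / (2 * n)`. Unlike
the latter, they lie in a compact box inside the orthant from time 1 on, since each half drift is
bounded above and away from zero. -/
theorem tendsto_of_degreeDrift (hπ : ∀ a, 0 < π a) (hκ : ∀ a b, 0 < κ a b) (hm : ∀ a, 1 ≤ m a)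
    {η : Fin K → ℝ} (hη : IsPotentialMinimizer π κ m η) {Y : ℕ → Fin K → ℝ}
    (hY : ∀ n a, 0 ≤ Y n a)
    (h : ∀ a, Tendsto (fun n : ℕ => Y n a / n -
      (∑ i ∈ Finset.range n, degreeDrift π κ m (Y i) a) / n) atTop (𝓝 0)) (a : Fin K) :
    Tendsto (fun n : ℕ => Y n a / n) atTop (𝓝 (2 * η a)) := by
  have hc : ∀ j, 0 < (m j : ℝ) * π j := fun j =>
    mul_pos (by exact_mod_cast hm j) (hπ j)
  -- Averages are at least `m j * π j / 2`; this `lo` leaves room for `w`, which is eventually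
  -- within `lo` of `z`. The upper end `M + 1` plays the same role.
  obtain ⟨lo, hlo, hloc⟩ : ∃ lo > 0, ∀ j, lo < (m j : ℝ) * π j / 4 := by
    have : Nonempty (Fin K) := ⟨a⟩
    obtain ⟨i, hi⟩ := Finite.exists_min fun j : Fin K => (m j : ℝ) * π j
    exact ⟨(m i : ℝ) * π i / 5, by linarith [hc i], fun j => by linarith [hc i, hi j]⟩
  set M : ℝ := ∑ b, (m b : ℝ) * π b with hM
  have hcM : ∀ j, (m j : ℝ) * π j ≤ M := fun j =>
    Finset.single_le_sum (f := fun j => (m j : ℝ) * π j) (fun j _ => (hc j).le) (Finset.mem_univ j)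
  set box : Set (Fin K → ℝ) := Set.pi Set.univ fun _ => Set.Icc lo (M + 1) with hbox
  have hboxpos : box ⊆ {y | ∀ i, 0 < y i} := fun y hy i => hlo.trans_le (hy i trivial).1
  have hcomp : IsCompact box := isCompact_univ_pi fun _ => isCompact_Icc
  set f : ℕ → Fin K → ℝ := fun n a => degreeDrift π κ m (Y n) a / 2 with hf
  set z : ℕ → Fin K → ℝ := fun n a => (∑ i ∈ Finset.range n, f i a) / n with hz
  set w : ℕ → Fin K → ℝ := fun n a => Y n a / (2 * n) with hw
  have hf1 : ∀ n a, (m a : ℝ) * π a / 2 ≤ f n a := fun n a => by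
    have := mul_nonneg (hY n a) (attachRate_nonneg (m := m) hπ hκ (hY n) a)
    simp only [hf, degreeDrift]
    linarith
  have hf2 : ∀ n a, f n a ≤ M := fun n a => by
    have := mul_attachRate_le (m := m) hπ hκ (hY n) a
    have := hcM a
    simp only [hf, degreeDrift]
    linarith
  have hz1 : ∀ n, 1 ≤ n → ∀ a, (m a : ℝ) * π a / 2 ≤ z n a := fun n hn a => by
    have hn0 : (0 : ℝ) < n := by exact_mod_cast hn
    simp only [hz]
    rw [le_div_iff₀ hn0]
    have := Finset.card_nsmul_le_sum (Finset.range n) (fun i => f i a) _ fun i _ => hf1 i a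
    simp only [Finset.card_range, nsmul_eq_mul] at this
    linarith
  have hz2 : ∀ n, 1 ≤ n → ∀ a, z n a ≤ M := fun n hn a => by
    have hn0 : (0 : ℝ) < n := by exact_mod_cast hn
    simp only [hz]
    rw [div_le_iff₀ hn0]
    have := Finset.sum_le_card_nsmul (Finset.range n) (fun i => f i a) _ fun i _ => hf2 i a
    simp only [Finset.card_range, nsmul_eq_mul] at this
    linarith
  have hzw : ∀ a, Tendsto (fun n => w n a - z n a) atTop (𝓝 0) := fun a => by
    have := (h a).const_mul (1 / 2)
    simp only [mul_zero] at this
    refine this.congr fun n => ?_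
    simp only [hw, hz, hf, ← Finset.sum_div]
    rw [div_right_comm _ (2 : ℝ), mul_comm (2 : ℝ), ← div_div]
    ring
  have hzbox : ∀ n, 1 ≤ n → z n ∈ box := fun n hn a _ =>
    ⟨by linarith [hz1 n hn a, hloc a, hc a], by linarith [hz2 n hn a]⟩
  have hzbox' : ∀ᶠ n in atTop, z n ∈ box := (eventually_ge_atTop 1).mono hzbox
  have hwbox : ∀ᶠ n in atTop, w n ∈ box := by
    have h1 : ∀ a, ∀ᶠ n in atTop, |w n a - z n a| < min 1 lo := fun a => by
      have h2 : Tendsto (fun n => |w n a - z n a|) atTop (𝓝 0) := by simpa using (hzw a).abs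
      exact h2.eventually_lt_const (lt_min one_pos hlo)
    filter_upwards [eventually_all.2 h1, eventually_ge_atTop 1] with n hn hn1 a _
    have h2 := abs_lt.1 ((hn a).trans_le (min_le_left _ _))
    have h3 := abs_lt.1 ((hn a).trans_le (min_le_right _ _))
    exact ⟨by linarith [hz1 n hn1 a, hloc a], by linarith [hz2 n hn1 a]⟩
  have hdriftc : ContinuousOn (degreeDrift π κ m) box := by
    refine continuousOn_pi.2 fun a => ?_
    exact continuousOn_const.add (ContinuousOn.mul (by fun_prop)
      (continuousOn_pi.1 ((attachRate_continuousOn hκ).mono hboxpos) a))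
  have hgradc : ContinuousOn (potentialGrad π κ m) box := (potentialGrad_continuousOn hκ).mono hboxpos
  -- By homogeneity the drift at `Y n` equals the drift at `w n`, which uniform continuity compares
  -- with that at `z n`.
  have hr : ∀ a, Tendsto (fun n => f n a - degreeDrift π κ m (z n) a / 2) atTop (𝓝 0) := fun a => by
    have h1 := UniformContinuousOn.tendsto_sub
      (hcomp.uniformContinuousOn_of_continuous hdriftc) hwbox hzbox' (tendsto_pi_nhds.2 hzw)
    have h2 := (tendsto_pi_nhds.1 h1 a).const_mul (1 / 2)
    simp only [Pi.zero_apply, mul_zero] at h2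
    refine h2.congr' ?_
    filter_upwards [eventually_ge_atTop 1] with n hn
    have hn0 : (2 * n : ℝ) ≠ 0 := by positivity
    have : degreeDrift π κ m (w n) a = degreeDrift π κ m (Y n) a := degreeDrift_div hn0 (Y n) a
    simp only [hf, Pi.sub_apply]
    rw [this]
    ring
  have hzsucc : ∀ n a, z (n + 1) a = z n a + (f n a - z n a) / ((n : ℝ) + 1) := fun n a =>
    average_succ (fun i => f i a) n
  have hhb : ∀ a, ∀ᶠ n in atTop, |f n a - z n a| ≤ M := fun a => by
    filter_upwards [eventually_ge_atTop 1] with n hn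
    rw [abs_le]
    exact ⟨by linarith [hf1 n a, hz2 n hn a, hc a], by linarith [hz1 n hn a, hf2 n a, hc a]⟩
  have hzd : Tendsto (fun n => z (n + 1) - z n) atTop (𝓝 0) := by
    refine tendsto_pi_nhds.2 fun a => ?_
    have := tendsto_mul_zero_of_bounded (hhb a) tendsto_one_div_add_atTop_nhds_zero_nat
    refine this.congr fun n => ?_
    simp only [Pi.sub_apply]
    rw [hzsucc]
    ring
  have hq := UniformContinuousOn.tendsto_sub (hcomp.uniformContinuousOn_of_continuous hgradc)
    ((tendsto_add_atTop_nat 1).eventually hzbox') hzbox' hzd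
  obtain ⟨G, hG⟩ := hcomp.exists_bound_of_continuousOn hgradc
  -- Two errors: the drift is taken at `w n` instead of `z n`, and the gradient at `z (n + 1)`
  -- instead of `z n`.
  set e : ℕ → ℝ := fun n =>
    ∑ a, potentialGrad π κ m (z n) a * (f n a - degreeDrift π κ m (z n) a / 2) +
    ∑ a, (f n a - z n a) * (potentialGrad π κ m (z (n + 1)) a - potentialGrad π κ m (z n) a) with he
  have he0 : Tendsto e atTop (𝓝 0) := by
    have h1 : Tendsto (fun n => ∑ a, potentialGrad π κ m (z n) a *
        (f n a - degreeDrift π κ m (z n) a / 2)) atTop (𝓝 (∑ a : Fin K, 0)) := by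
      refine tendsto_finsetSum _ fun a _ => tendsto_mul_zero_of_bounded (C := G) ?_ (hr a)
      filter_upwards [hzbox'] with n hn
      exact (norm_le_pi_norm (potentialGrad π κ m (z n)) a).trans (hG _ hn)
    have h2 : Tendsto (fun n => ∑ a, (f n a - z n a) * (potentialGrad π κ m (z (n + 1)) a -
        potentialGrad π κ m (z n) a)) atTop (𝓝 (∑ a : Fin K, 0)) :=
      tendsto_finsetSum _ fun a _ => tendsto_mul_zero_of_bounded (hhb a) (tendsto_pi_nhds.1 hq a)
    simpa using h1.add h2
  have hstep : ∀ᶠ n : ℕ in atTop, potential π κ m (z (n + 1)) ≤ potential π κ m (z n) +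
      (e n - ∑ a, z n a * potentialGrad π κ m (z n) a ^ 2) / ((n : ℝ) + 1) := by
    filter_upwards [hzbox', eventually_ge_atTop 1] with n hn hn1
    -- The tangent plane is taken at the new point, so convexity bounds the new value with no
    -- second-order term.
    have h1 := potential_ge (m := m) (fun a => (hπ a).le) hκ (hboxpos (hzbox (n + 1) (by omega)))
      (hboxpos hn)
    have h2 : 0 ≤ ∑ j, (m j : ℝ) * π j * (√(z n j / z (n + 1) j) - 1) ^ 2 :=
      Finset.sum_nonneg fun j _ => mul_nonneg (hc j).le (sq_nonneg _)
    have h3 : ∑ a, potentialGrad π κ m (z (n + 1)) a * (z n a - z (n + 1) a) =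
        - ((e n - ∑ a, z n a * potentialGrad π κ m (z n) a ^ 2) / ((n : ℝ) + 1)) := by
      simp only [he]
      rw [← Finset.sum_add_distrib, ← Finset.sum_sub_distrib, Finset.sum_div,
        ← Finset.sum_neg_distrib]
      refine Finset.sum_congr rfl fun a _ => ?_
      have h4 := mul_potentialGrad (π := π) (κ := κ) (m := m) (hboxpos hn a).ne'
      rw [hzsucc]
      have h5 : degreeDrift π κ m (z n) a / 2 =
        z n a - z n a * potentialGrad π κ m (z n) a := by linarith
      rw [h5]
      ring
    linarith
  have hu0 : ∀ᶠ n in atTop, 0 ≤ potential π κ m (z n) - potential π κ m η :=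
    hzbox'.mono fun n hn => sub_nonneg.2 (hη.2 _ (hboxpos hn))
  have hu : Tendsto (fun n => potential π κ m (z n) - potential π κ m η) atTop (𝓝 0) := by
    refine tendsto_zero_of_descent (ε := fun n => |e n|) hu0 (by simpa using he0.abs) ?_ ?_
    · filter_upwards [hstep, hzbox'] with n hn hnb
      have hn1 : (0 : ℝ) < (n : ℝ) + 1 := by positivity
      have h1 : 0 ≤ ∑ a, z n a * potentialGrad π κ m (z n) a ^ 2 :=
        Finset.sum_nonneg fun a _ => mul_nonneg (hboxpos hnb a).le (sq_nonneg _)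
      have h2 : (e n - ∑ a, z n a * potentialGrad π κ m (z n) a ^ 2) / ((n : ℝ) + 1) ≤ |e n| := by
        rw [div_le_iff₀ hn1]
        nlinarith [le_abs_self (e n), abs_nonneg (e n), (Nat.cast_nonneg n : (0 : ℝ) ≤ n)]
      linarith
    · intro δ hδ
      set B : ℝ := M + 1 + ∑ a, η a with hB
      have hM0 : 0 ≤ M := Finset.sum_nonneg fun j _ => (hc j).le
      have hηs : ∀ a, η a ≤ ∑ a, η a := fun a =>
        Finset.single_le_sum (fun a _ => (hη.1 a).le) (Finset.mem_univ a)
      have hB0 : 0 < B := by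
        have : 0 ≤ ∑ a, η a := Finset.sum_nonneg fun a _ => (hη.1 a).le
        linarith
      set D : ℝ := lo * (δ / B) ^ 2 / (K + 1) with hD
      have hD0 : 0 < D := by positivity
      have hes : ∀ᶠ n in atTop, |e n| < D / 2 :=
        (by simpa using he0.abs : Tendsto (fun n => |e n|) atTop (𝓝 0)).eventually_lt_const
          (by positivity)
      refine ⟨D / 2, by positivity, ?_⟩
      filter_upwards [hstep, hzbox', hes] with n hn hnb hen hδn
      have hn1 : (0 : ℝ) < (n : ℝ) + 1 := by positivity
      -- Convexity bounds the excess over the minimum by the gradient times the distance to `η`, so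
      -- an excess of `δ` forces dissipation at least `D`; the error `e n` eats at most half of it.
      have h1 := potential_ge (m := m) (fun a => (hπ a).le) hκ (hboxpos hnb) hη.1
      have h2 : 0 ≤ ∑ j, (m j : ℝ) * π j * (√(η j / z n j) - 1) ^ 2 :=
        Finset.sum_nonneg fun j _ => mul_nonneg (hc j).le (sq_nonneg _)
      have h3 : -∑ a, potentialGrad π κ m (z n) a * (η a - z n a) ≤
          ∑ a, |potentialGrad π κ m (z n) a| * B := by
        rw [← Finset.sum_neg_distrib]
        refine Finset.sum_le_sum fun a _ => ?_
        have h4 : |η a - z n a| ≤ B := by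
          have h5 := hnb a trivial
          have := hηs a
          have := hη.1 a
          rw [abs_le]
          exact ⟨by linarith [h5.2], by linarith [h5.1]⟩
        refine (neg_le_abs _).trans ?_
        rw [abs_mul]
        exact mul_le_mul_of_nonneg_left h4 (abs_nonneg _)
      have h6 := le_sum_mul_sq_of_le_sum_abs hlo hB0 hδ (fun a => (hnb a trivial).1)
        (by linarith : δ ≤ ∑ a, |potentialGrad π κ m (z n) a| * B)
      have h7 : (e n - ∑ a, z n a * potentialGrad π κ m (z n) a ^ 2) / ((n : ℝ) + 1) ≤
          -(D / 2) / ((n : ℝ) + 1) := by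
        gcongr
        linarith [le_abs_self (e n)]
      rw [neg_div] at h7
      linarith
  have hsq : Tendsto (fun n => (√(z n a / η a) - 1) ^ 2) atTop (𝓝 0) := by
    have h1 := hu.const_mul (2 / ((m a : ℝ) * π a))
    simp only [mul_zero] at h1
    refine squeeze_zero' (Eventually.of_forall fun n => sq_nonneg _) ?_ h1
    filter_upwards [hzbox'] with n hn
    have h2 := potential_ge (m := m) (fun a => (hπ a).le) hκ hη.1 (hboxpos hn)
    simp only [potentialGrad_eq_zero hκ hη, zero_mul, Finset.sum_const_zero] at h2
    have h3 : (m a : ℝ) * π a * (√(z n a / η a) - 1) ^ 2 ≤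
        ∑ j, (m j : ℝ) * π j * (√(z n j / η j) - 1) ^ 2 :=
      Finset.single_le_sum (f := fun j => (m j : ℝ) * π j * (√(z n j / η j) - 1) ^ 2)
        (fun j _ => mul_nonneg (hc j).le (sq_nonneg _)) (Finset.mem_univ a)
    rw [div_mul_eq_mul_div, le_div_iff₀ (hc a)]
    linarith
  have hz0 : Tendsto (fun n => z n a) atTop (𝓝 (η a)) := by
    have h1 : Tendsto (fun n => |√(z n a / η a) - 1|) atTop (𝓝 0) := by
      have := hsq.sqrt
      simpa [Real.sqrt_sq_eq_abs] using this
    have h2 := ((tendsto_zero_iff_abs_tendsto_zero _).2 h1).add_const 1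
    simp only [zero_add, sub_add_cancel] at h2
    have h3 := (h2.pow 2).const_mul (η a)
    simp only [one_pow, mul_one] at h3
    refine h3.congr' ?_
    filter_upwards [hzbox'] with n hn
    rw [Real.sq_sqrt (div_nonneg (hboxpos hn a).le (hη.1 a).le)]
    field_simp [(hη.1 a).ne']
  have h8 := ((hzw a).add hz0).const_mul 2
  simp only [zero_add, sub_add_cancel] at h8
  refine h8.congr fun n => ?_
  simp only [hw]
  rw [mul_comm (2 : ℝ) (n : ℝ), ← div_div]
  ring

end Dynamics

/-! ### Gamma asymptotics and the limiting degree distribution. -/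

theorem Gamma_add_nat_eq_prod {s : ℝ} (hs : 0 < s) (n : ℕ) :
    Real.Gamma (s + n) = Real.Gamma s * ∏ j ∈ Finset.range n, (s + j) := by
  induction n with
  | zero => simp
  | succ n ih =>
    rw [Finset.prod_range_succ, ← mul_assoc, ← ih, Nat.cast_succ, ← add_assoc,
      Real.Gamma_add_one (by positivity), mul_comm]

/-- For `k ≥ 1` the sequence is Euler's `Real.GammaSeq s k` divided by `Γ(s)`. -/
theorem tendsto_Gamma_ratio {s : ℝ} (hs : 0 < s) :
    Tendsto (fun k : ℕ => Real.Gamma k / Real.Gamma (k + 1 + s) * (k : ℝ) ^ (1 + s)) atTop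
      (𝓝 1) := by
  have hΓ := (Real.Gamma_pos_of_pos hs).ne'
  have h := (Real.GammaSeq_tendsto_Gamma s).div_const (Real.Gamma s)
  rw [div_self hΓ] at h
  refine h.congr' ?_
  filter_upwards [eventually_ge_atTop 1] with k hk
  have hk0 : (0 : ℝ) < k := by exact_mod_cast hk
  have h1 : Real.Gamma (k + 1 + s) = Real.Gamma s * ∏ j ∈ Finset.range (k + 1), (s + j) := by
    rw [← Gamma_add_nat_eq_prod hs]
    push_cast
    ring_nf
  have h2 : (k.factorial : ℝ) = k * Real.Gamma k := by
    rw [← Real.Gamma_nat_eq_factorial, Real.Gamma_add_one hk0.ne']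
  have h3 : ∏ j ∈ Finset.range (k + 1), (s + (j : ℝ)) ≠ 0 :=
    Finset.prod_ne_zero_iff.2 fun j _ => by positivity
  rw [h1, Real.GammaSeq, h2, Real.rpow_add hk0, Real.rpow_one]
  field_simp

section LimitPMF

variable {φ : ℝ} {r : ℕ}

/-- The mass is a difference of consecutive tails: the tail from `k` on is `Γ(r + s) Γ(k) / (Γ(r)
Γ(k + s))` with `s = 2 / φ`, which equals 1 at `k = r`. -/
theorem limitPMF_eq_sub (hφ : 0 < φ) {k : ℕ} (hk : 1 ≤ k) :
    limitPMF φ r k = Real.Gamma (r + 2 / φ) / Real.Gamma r *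
        (Real.Gamma k / Real.Gamma (k + 2 / φ)) -
      Real.Gamma (r + 2 / φ) / Real.Gamma r *
        (Real.Gamma ((k + 1 : ℕ) : ℝ) / Real.Gamma ((k + 1 : ℕ) + 2 / φ)) := by
  have hs : 0 < 2 / φ := by positivity
  unfold limitPMF
  set s := 2 / φ
  have hk0 : (0 : ℝ) < k := by exact_mod_cast hk
  have hks : (k : ℝ) + s ≠ 0 := by positivity
  have h1 : Real.Gamma (k + 1 + s) = (k + s) * Real.Gamma (k + s) := by
    rw [← Real.Gamma_add_one hks]
    ring_nf
  push_cast
  rw [h1, Real.Gamma_add_one hk0.ne']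
  have h2 : Real.Gamma (k + s) ≠ 0 := (Real.Gamma_pos_of_pos (by positivity)).ne'
  rw [div_mul_div_comm, div_mul_div_comm]
  field_simp
  ring

theorem limitPMF_nonneg (hφ : 0 < φ) (k : ℕ) : 0 ≤ limitPMF φ r k := by
  unfold limitPMF
  have hs : 0 < 2 / φ := by positivity
  have h1 : 0 ≤ Real.Gamma (r : ℝ) := Real.Gamma_nonneg_of_nonneg (by positivity)
  have h2 : 0 ≤ Real.Gamma (k : ℝ) := Real.Gamma_nonneg_of_nonneg (by positivity)
  have h3 : 0 ≤ Real.Gamma (r + 2 / φ) := Real.Gamma_nonneg_of_nonneg (by positivity)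
  have h4 : 0 ≤ Real.Gamma (k + 1 + 2 / φ) := Real.Gamma_nonneg_of_nonneg (by positivity)
  positivity

theorem tendsto_Gamma_div_Gamma_add {s : ℝ} (hs : 0 < s) :
    Tendsto (fun k : ℕ => Real.Gamma k / Real.Gamma (k + s)) atTop (𝓝 0) := by
  have h1 : Tendsto (fun k : ℕ => (k : ℝ) ^ (-s)) atTop (𝓝 0) :=
    (tendsto_rpow_neg_atTop hs).comp tendsto_natCast_atTop_atTop
  have h2 : Tendsto (fun k : ℕ => (k : ℝ) ^ (-(1 + s))) atTop (𝓝 0) :=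
    (tendsto_rpow_neg_atTop (by positivity)).comp tendsto_natCast_atTop_atTop
  have h3 := (tendsto_Gamma_ratio hs).mul (h1.add (h2.const_mul s))
  simp only [mul_zero, add_zero] at h3
  refine h3.congr' ?_
  filter_upwards [eventually_ge_atTop 1] with k hk
  have hk0 : (0 : ℝ) < k := by exact_mod_cast hk
  have hks : (k : ℝ) + s ≠ 0 := by positivity
  have h4 : Real.Gamma (k + 1 + s) = (k + s) * Real.Gamma (k + s) := by
    rw [← Real.Gamma_add_one hks]
    ring_nf
  have h5 : Real.Gamma (k + s) ≠ 0 := (Real.Gamma_pos_of_pos (by positivity)).ne'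
  have h6 : (k : ℝ) ^ (-s) = k * (k : ℝ) ^ (-(1 + s)) := by
    rw [← Real.rpow_one_add' hk0.le]
    · ring_nf
    · ring_nf
      exact neg_ne_zero.2 hs.ne'
  have h7 : (k : ℝ) ^ (1 + s) * (k : ℝ) ^ (-(1 + s)) = 1 := by
    rw [← Real.rpow_add hk0, add_neg_cancel, Real.rpow_zero]
  rw [h4, h6]
  calc Real.Gamma k / ((k + s) * Real.Gamma (k + s)) * (k : ℝ) ^ (1 + s) *
        (k * (k : ℝ) ^ (-(1 + s)) + s * (k : ℝ) ^ (-(1 + s)))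
      = Real.Gamma k / ((k + s) * Real.Gamma (k + s)) * (k + s) *
          ((k : ℝ) ^ (1 + s) * (k : ℝ) ^ (-(1 + s))) := by ring
    _ = Real.Gamma k / Real.Gamma (k + s) := by
      rw [h7]
      field_simp

theorem hasSum_limitPMF (hφ : 0 < φ) (hr : 1 ≤ r) :
    HasSum (fun j : ℕ => limitPMF φ r (r + j)) 1 := by
  have hs : 0 < 2 / φ := by positivity
  rw [hasSum_iff_tendsto_nat_of_nonneg fun j => limitPMF_nonneg hφ _]
  set T : ℕ → ℝ := fun j => Real.Gamma (r + 2 / φ) / Real.Gamma r *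
        (Real.Gamma ((r + j : ℕ) : ℝ) / Real.Gamma ((r + j : ℕ) + 2 / φ)) with hT
  have h1 : ∀ n, ∑ j ∈ Finset.range n, limitPMF φ r (r + j) = T 0 - T n := by
    intro n
    rw [← Finset.sum_range_sub' T n]
    exact Finset.sum_congr rfl fun j _ => limitPMF_eq_sub hφ (by omega)
  have hr0 : (0 : ℝ) < r := by exact_mod_cast hr
  have h2 : T 0 = 1 := by
    have h3 := (Real.Gamma_pos_of_pos hr0).ne'
    have h4 : Real.Gamma (r + 2 / φ) ≠ 0 := (Real.Gamma_pos_of_pos (by positivity)).ne'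
    simp only [hT, add_zero]
    rw [div_mul_div_comm, mul_comm]
    exact div_self (mul_ne_zero h3 h4)
  have h5 : Tendsto T atTop (𝓝 0) := by
    have h6 := ((tendsto_Gamma_div_Gamma_add hs).comp
      (tendsto_add_atTop_nat r)).const_mul (Real.Gamma (r + 2 / φ) / Real.Gamma r)
    rw [mul_zero] at h6
    refine h6.congr fun n => ?_
    simp only [hT, Function.comp_apply, add_comm r n]
  simp only [h1, h2]
  simpa using h5.const_sub 1

theorem limitPMF_isEquivalent (hφ : 0 < φ) (hr : 1 ≤ r) :
    (fun k : ℕ => limitPMF φ r k) ~[atTop] fun k : ℕ =>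
      2 / φ * (Real.Gamma (r + 2 / φ) / Real.Gamma r) * (k : ℝ) ^ (-(1 + 2 / φ)) := by
  have hs : 0 < 2 / φ := by positivity
  have hr0 : (0 : ℝ) < r := by exact_mod_cast hr
  have h3 := (Real.Gamma_pos_of_pos hr0).ne'
  have h4 : Real.Gamma (r + 2 / φ) ≠ 0 := (Real.Gamma_pos_of_pos (by positivity)).ne'
  refine (isEquivalent_of_tendsto_one ?_)
  refine (tendsto_Gamma_ratio hs).congr' ?_
  filter_upwards [eventually_ge_atTop 1] with k hk
  have hk0 : (0 : ℝ) < k := by exact_mod_cast hk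
  have h5 : (k : ℝ) ^ (1 + 2 / φ) ≠ 0 := (Real.rpow_pos_of_pos hk0 _).ne'
  simp only [Pi.div_apply, limitPMF]
  rw [Real.rpow_neg hk0.le]
  set s := 2 / φ
  have hs' := hs.ne'
  field_simp

/-- Together with `limitPMF_succ`, this puts the Gamma quotient in the form in which the rate
equations produce it: a birth term at `r`, then inflow over `1 + φ / 2 * k`. -/
theorem limitPMF_self (hφ : 0 < φ) (hr : 1 ≤ r) : limitPMF φ r r = 1 / (1 + φ / 2 * r) := by
  have hs : 0 < 2 / φ := by positivity
  have hr0 : (0 : ℝ) < r := by exact_mod_cast hr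
  have h3 := (Real.Gamma_pos_of_pos hr0).ne'
  have h4 : Real.Gamma (r + 2 / φ) ≠ 0 := (Real.Gamma_pos_of_pos (by positivity)).ne'
  have h5 : Real.Gamma (r + 1 + 2 / φ) = (r + 2 / φ) * Real.Gamma (r + 2 / φ) := by
    rw [← Real.Gamma_add_one (by positivity)]
    ring_nf
  unfold limitPMF
  rw [h5]
  field_simp
  ring

theorem limitPMF_succ (hφ : 0 < φ) {k : ℕ} (hk : 1 ≤ k) :
    limitPMF φ r (k + 1) = φ / 2 * k * limitPMF φ r k / (1 + φ / 2 * ((k + 1 : ℕ) : ℝ)) := by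
  have hs : 0 < 2 / φ := by positivity
  have hk0 : (0 : ℝ) < k := by exact_mod_cast hk
  have h5 : Real.Gamma (k + 1 + 1 + 2 / φ) =
      (k + 1 + 2 / φ) * Real.Gamma (k + 1 + 2 / φ) := by
    rw [← Real.Gamma_add_one (by positivity)]
    ring_nf
  unfold limitPMF
  push_cast
  rw [h5, Real.Gamma_add_one hk0.ne']
  have h6 : (k : ℝ) + 1 + 2 / φ = 2 / φ * (1 + φ / 2 * (k + 1)) := by
    field_simp
    ring
  have h7 : 1 + φ / 2 * ((k : ℝ) + 1) ≠ 0 := by positivity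
  nth_rewrite 1 [h6]
  set D := Real.Gamma (k + 1 + 2 / φ)
  set A := Real.Gamma (r + 2 / φ)
  have hφ' := hφ.ne'
  field_simp

end LimitPMF

/-! ### A law of large numbers for countable Markov chains. -/

theorem abs_sub_le_of_abs_increment_le {x : ℕ → ℝ} {B : ℝ} (hB : ∀ n, |x (n + 1) - x n| ≤ B)
    (n j : ℕ) : |x (n + j) - x n| ≤ j * B := by
  induction j with
  | zero => simp
  | succ j ih =>
    calc |x (n + (j + 1)) - x n| = |(x (n + j + 1) - x (n + j)) + (x (n + j) - x n)| := by
          rw [sub_add_sub_cancel, add_assoc]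
      _ ≤ B + j * B := (abs_add_le _ _).trans (add_le_add (hB _) ih)
      _ = ((j + 1 : ℕ) : ℝ) * B := by push_cast; ring

/-- An index lies at most `2 * k` steps after the last square `k ^ 2`, so `x` moves by at most `2 *
k * B` in between, negligible against `k ^ 2`. -/
theorem tendsto_div_of_tendsto_sq_div {x : ℕ → ℝ} {B : ℝ} (hB : ∀ n, |x (n + 1) - x n| ≤ B)
    (h : Tendsto (fun k : ℕ => x (k ^ 2) / (k : ℝ) ^ 2) atTop (𝓝 0)) :
    Tendsto (fun n : ℕ => x n / n) atTop (𝓝 0) := by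
  have hB0 : 0 ≤ B := (abs_nonneg _).trans (hB 0)
  have hsqrt : Tendsto Nat.sqrt atTop atTop :=
    tendsto_atTop_atTop.2 fun b => ⟨b ^ 2, fun n hn => Nat.le_sqrt'.2 hn⟩
  have h1 : Tendsto (fun k : ℕ => |x (k ^ 2) / (k : ℝ) ^ 2| + 2 * B / k) atTop (𝓝 0) := by
    simpa using h.abs.add (tendsto_const_div_atTop_nhds_zero_nat (2 * B))
  refine squeeze_zero_norm' ?_ (h1.comp hsqrt)
  filter_upwards [eventually_ge_atTop 1] with n hn
  have hk1 : 1 ≤ Nat.sqrt n := Nat.le_sqrt'.2 (by simpa using hn)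
  have hle : Nat.sqrt n ^ 2 ≤ n := Nat.sqrt_le' n
  have hlt : n < (Nat.sqrt n + 1) ^ 2 := Nat.lt_succ_sqrt' n
  simp only [Function.comp_apply, Real.norm_eq_abs]
  generalize Nat.sqrt n = k at *
  obtain ⟨j, rfl⟩ := Nat.exists_eq_add_of_le hle
  have hj : j ≤ 2 * k := by nlinarith
  have hk0 : (0 : ℝ) < k := by exact_mod_cast hk1
  have h2 := abs_sub_le_of_abs_increment_le hB (k ^ 2) j
  have h3 : (j : ℝ) * B ≤ 2 * k * B := by
    gcongr
    exact_mod_cast hj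
  have h4 : |x (k ^ 2 + j)| ≤ |x (k ^ 2)| + 2 * k * B := by
    have := abs_sub_abs_le_abs_sub (x (k ^ 2 + j)) (x (k ^ 2))
    linarith
  rw [abs_div, abs_div, abs_of_nonneg (by positivity : (0 : ℝ) ≤ ((k ^ 2 + j : ℕ) : ℝ)),
    abs_of_nonneg (by positivity : (0 : ℝ) ≤ (k : ℝ) ^ 2)]
  calc |x (k ^ 2 + j)| / ((k ^ 2 + j : ℕ) : ℝ) ≤ (|x (k ^ 2)| + 2 * k * B) / (k : ℝ) ^ 2 := by
        gcongr
        push_cast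
        linarith [(Nat.cast_nonneg j : (0 : ℝ) ≤ j)]
    _ = |x (k ^ 2)| / (k : ℝ) ^ 2 + 2 * B / k := by
        field_simp

section Chain

/-- Histories are tuples so that a countable state space has countably many of them; `Fin.ofNat`
extends a tuple to all of `ℕ`, with irrelevant values beyond `n`. -/
theorem history_eq_iff {Ω S : Type*} {X : ℕ → Ω → S} (n : ℕ) (g : Fin (n + 1) → S) (ω : Ω) :
    (fun i : Fin (n + 1) => X i ω) = g ↔ ∀ i ≤ n, X i ω = g (Fin.ofNat (n + 1) i) := by
  rw [funext_iff]
  constructor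
  · intro h i hi
    rw [← h]
    simp [Nat.mod_eq_of_lt (Nat.lt_succ_of_le hi)]
  · intro h i
    rw [h i (by omega)]
    simp

variable {Ω : Type*} [MeasurableSpace Ω] {P : Measure Ω}

/-- A process with bounded increments whose second moment grows at most linearly is almost
surely sublinear. -/
theorem ae_tendsto_div_of_integral_sq_le {S : ℕ → Ω → ℝ} {B C : ℝ}
    (hS : ∀ n, Measurable (S n)) (hB : ∀ n ω, |S (n + 1) ω - S n ω| ≤ B)
    (hint : ∀ n, Integrable (fun ω => S n ω ^ 2) P) (hC : ∀ n : ℕ, ∫ ω, S n ω ^ 2 ∂P ≤ C * n) :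
    ∀ᵐ ω ∂P, Tendsto (fun n : ℕ => S n ω / n) atTop (𝓝 0) := by
  -- Along squares the expected values of these terms are at most `C / (k + 1) ^ 2`, hence summable;
  -- so the random series is almost surely finite and its terms tend to zero.
  set F : ℕ → Ω → ENNReal := fun k ω => ENNReal.ofReal ((S ((k + 1) ^ 2) ω / ((k : ℝ) + 1) ^ 2) ^ 2)
    with hF
  have hFm : ∀ k, Measurable (F k) := fun k =>
    (((hS _).div_const _).pow_const 2).ennreal_ofReal
  have hC0 : 0 ≤ C := by
    have := (integral_nonneg fun ω => sq_nonneg (S 1 ω)).trans (hC 1)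
    simpa using this
  have hFi : ∀ k, ∫⁻ ω, F k ω ∂P ≤ ENNReal.ofReal (C * (1 / ((k : ℝ) + 1) ^ 2)) := by
    intro k
    have hk : (0 : ℝ) < (k : ℝ) + 1 := by positivity
    have h1 : Integrable (fun ω => (S ((k + 1) ^ 2) ω / ((k : ℝ) + 1) ^ 2) ^ 2) P := by
      simp only [div_pow]
      exact (hint _).div_const _
    rw [← ofReal_integral_eq_lintegral_ofReal h1 (Eventually.of_forall fun ω => sq_nonneg _)]
    refine ENNReal.ofReal_le_ofReal ?_
    simp only [div_pow]
    rw [integral_div, div_le_iff₀ (by positivity)]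
    refine (hC _).trans (le_of_eq ?_)
    push_cast
    field_simp
  have hsum : ∑' k, ∫⁻ ω, F k ω ∂P ≠ ⊤ := by
    refine ne_top_of_le_ne_top ?_ (ENNReal.tsum_le_tsum hFi)
    have h2 : Summable fun k : ℕ => C * (1 / ((k : ℝ) + 1) ^ 2) := by
      have := (summable_nat_add_iff 1).2 (Real.summable_one_div_nat_pow.2 one_lt_two)
      refine Summable.mul_left C ?_
      simpa using this
    rw [← ENNReal.ofReal_tsum_of_nonneg (fun k => by positivity) h2]
    exact ENNReal.ofReal_ne_top
  rw [← lintegral_tsum fun k => (hFm k).aemeasurable] at hsum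
  filter_upwards [ae_lt_top (Measurable.tsum hFm) hsum] with ω hω
  refine tendsto_div_of_tendsto_sq_div (fun n => hB n ω) ?_
  rw [← tendsto_add_atTop_iff_nat 1]
  have h3 : Tendsto (fun k => F k ω) atTop (𝓝 0) :=
    ENNReal.tendsto_atTop_zero_of_tsum_ne_top hω.ne
  have h4 := (ENNReal.tendsto_toReal ENNReal.zero_ne_top).comp h3
  have h5 : Tendsto (fun k : ℕ => (S ((k + 1) ^ 2) ω / ((k : ℝ) + 1) ^ 2) ^ 2) atTop (𝓝 0) := by
    refine h4.congr fun k => ?_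
    simp only [hF, Function.comp_apply]
    exact ENNReal.toReal_ofReal (sq_nonneg _)
  have h6 := h5.sqrt
  simp only [Real.sqrt_sq_eq_abs, Real.sqrt_zero] at h6
  refine ((tendsto_zero_iff_abs_tendsto_zero _).2 h6).congr fun k => ?_
  push_cast
  rfl

variable {S : Type*} [MeasurableSpace S] [MeasurableSingletonClass S]
  {X : ℕ → Ω → S} {p : S → S → ℝ}

theorem measurableSet_cylinder (hX : ∀ n, Measurable (X n)) (n : ℕ) (g : ℕ → S) :
    MeasurableSet {ω | ∀ i ≤ n, X i ω = g i} := by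
  have : {ω | ∀ i ≤ n, X i ω = g i} = ⋂ i, ⋂ (_ : i ≤ n), X i ⁻¹' {g i} := by
    ext ω
    simp
  rw [this]
  exact MeasurableSet.iInter fun i => MeasurableSet.iInter fun _ =>
    hX i (measurableSet_singleton _)

variable [Countable S] [IsProbabilityMeasure P]

/-- The Markov property in integrated form. Prescribing the next state by updating `g` at `n + 1`
gives the atoms of the law of `X (n + 1)` on the cylinder. -/
theorem setIntegral_cylinder (hX : ∀ n, Measurable (X n)) (hp : ∀ s t, 0 ≤ p s t)
    (hstep : ∀ (n : ℕ) (g : ℕ → S), P {ω | ∀ i ≤ n + 1, X i ω = g i} =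
      P {ω | ∀ i ≤ n, X i ω = g i} * ENNReal.ofReal (p (g n) (g (n + 1))))
    {f : S → ℝ} {C D : ℝ} (hf : ∀ s, |f s| ≤ C) (n : ℕ) (g : ℕ → S)
    (hD : HasSum (fun s => p (g n) s * f s) D) :
    ∫ ω in {ω | ∀ i ≤ n, X i ω = g i}, f (X (n + 1) ω) ∂P =
      P.real {ω | ∀ i ≤ n, X i ω = g i} * D := by
  set A := {ω | ∀ i ≤ n, X i ω = g i} with hA
  have hfm : Measurable f := measurable_of_countable f
  rw [← integral_map (hX (n + 1)).aemeasurable hfm.aestronglyMeasurable]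
  have : IsFiniteMeasure ((P.restrict A).map (X (n + 1))) := inferInstance
  rw [integral_countable (Integrable.of_bound hfm.aestronglyMeasurable C
    (Eventually.of_forall hf)), ← hD.tsum_eq, ← tsum_mul_left]
  refine tsum_congr fun s => ?_
  have h1 : ((P.restrict A).map (X (n + 1))) {s} = P A * ENNReal.ofReal (p (g n) s) := by
    rw [Measure.map_apply (hX _) (measurableSet_singleton s),
      Measure.restrict_apply (hX _ (measurableSet_singleton s))]
    have h2 := hstep n (Function.update g (n + 1) s)
    have h3 : {ω | ∀ i ≤ n + 1, X i ω = Function.update g (n + 1) s i} =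
        X (n + 1) ⁻¹' {s} ∩ A := by
      ext ω
      simp only [hA, Set.mem_ofPred_eq, Set.mem_inter_iff, Set.mem_preimage,
        Set.mem_singleton_iff]
      constructor
      · intro h
        refine ⟨by simpa using h (n + 1) le_rfl, fun i hi => ?_⟩
        have := h i (by omega)
        rwa [Function.update_of_ne (by omega)] at this
      · rintro ⟨h, h'⟩ i hi
        rcases Nat.lt_or_eq_of_le hi with hi | rfl
        · rw [Function.update_of_ne (by omega)]
          exact h' i (by omega)
        · simpa using h
    have h4 : {ω | ∀ i ≤ n, X i ω = Function.update g (n + 1) s i} = A := by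
      ext ω
      refine forall₂_congr fun i hi => ?_
      rw [Function.update_of_ne (by omega)]
    rw [h3, h4, Function.update_self, Function.update_of_ne (by omega)] at h2
    exact h2
  rw [measureReal_def, h1, ENNReal.toReal_mul, ENNReal.toReal_ofReal (hp _ _), smul_eq_mul,
    mul_assoc, measureReal_def]

/-- Almost surely, the chain makes only steps of positive probability. -/
theorem ae_step_ne_zero {Ω S : Type*} [MeasurableSpace Ω] {P : Measure Ω} [Countable S]
    {X : ℕ → Ω → S} {p : S → S → ℝ}
    (hstep : ∀ (n : ℕ) (g : ℕ → S), P {ω | ∀ i ≤ n + 1, X i ω = g i} =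
      P {ω | ∀ i ≤ n, X i ω = g i} * ENNReal.ofReal (p (g n) (g (n + 1)))) :
    ∀ᵐ ω ∂P, ∀ n, p (X n ω) (X (n + 1) ω) ≠ 0 := by
  rw [ae_all_iff]
  intro n
  have h : ∀ᵐ ω ∂P, ∀ g : Fin (n + 1 + 1) → S, (∀ i ≤ n + 1, X i ω = g (Fin.ofNat _ i)) →
      p (g (Fin.ofNat _ n)) (g (Fin.ofNat _ (n + 1))) ≠ 0 := by
    rw [ae_all_iff]
    intro g
    by_cases hg : p (g (Fin.ofNat _ n)) (g (Fin.ofNat _ (n + 1))) = 0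
    · have := hstep n fun i => g (Fin.ofNat _ i)
      simp only [hg, ENNReal.ofReal_zero, mul_zero] at this
      filter_upwards [measure_eq_zero_iff_ae_notMem.1 this] with ω hω hω'
      exact absurd hω' hω
    · exact Eventually.of_forall fun ω _ => hg
  filter_upwards [h] with ω hω
  have h1 := (history_eq_iff (X := X) (n + 1) (fun i => X i ω) ω).1 rfl
  have h2 := hω (fun i => X i ω) h1
  rwa [← h1 n (by omega), ← h1 (n + 1) le_rfl] at h2

/-- The centred step is orthogonal to the past: on each of the countably many histories `h` is
constant and `setIntegral_cylinder` makes the other factor integrate to zero. -/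
theorem integral_history_mul_eq_zero (hX : ∀ n, Measurable (X n)) (hp : ∀ s t, 0 ≤ p s t)
    (hstep : ∀ (n : ℕ) (g : ℕ → S), P {ω | ∀ i ≤ n + 1, X i ω = g i} =
      P {ω | ∀ i ≤ n, X i ω = g i} * ENNReal.ofReal (p (g n) (g (n + 1))))
    {Δ : S → S → ℝ} {D : S → ℝ} {C B : ℝ} (hΔ : ∀ s t, |Δ s t| ≤ C)
    (hD : ∀ s, HasSum (fun t => p s t * Δ s t) (D s)) (hDC : ∀ s, |D s| ≤ C) (n : ℕ)
    {h : (Fin (n + 1) → S) → ℝ} (hh : ∀ g, |h g| ≤ B) :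
    ∫ ω, h (fun i => X i ω) * (Δ (X n ω) (X (n + 1) ω) - D (X n ω)) ∂P = 0 := by
  set H : Ω → Fin (n + 1) → S := fun ω i => X i ω with hH
  have hHm : Measurable H := measurable_pi_lambda _ fun i => hX i
  set f : Ω → ℝ := fun ω => h (H ω) * (Δ (X n ω) (X (n + 1) ω) - D (X n ω)) with hf
  have hfm : Measurable f := by
    refine ((measurable_of_countable h).comp hHm).mul (Measurable.sub ?_ ?_)
    · exact (measurable_of_countable (Function.uncurry Δ)).comp ((hX n).prodMk (hX (n + 1)))
    · exact (measurable_of_countable D).comp (hX n)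
  have hfi : Integrable f P := by
    refine Integrable.of_bound hfm.aestronglyMeasurable (B * (C + C))
      (Eventually.of_forall fun ω => ?_)
    rw [Real.norm_eq_abs, abs_mul]
    exact mul_le_mul (hh _) ((abs_sub _ _).trans (add_le_add (hΔ _ _) (hDC _))) (abs_nonneg _)
      ((abs_nonneg _).trans (hh (H ω)))
  have hU : ⋃ g, H ⁻¹' {g} = Set.univ := by
    ext ω
    simp
  have hsum := hasSum_integral_iUnion (μ := P) (f := f) (s := fun g => H ⁻¹' {g})
    (fun g => hHm (measurableSet_singleton g))
    (fun g g' hg => Disjoint.preimage H (Set.disjoint_singleton.2 hg)) hfi.integrableOn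
  rw [hU, setIntegral_univ] at hsum
  refine hsum.unique ?_
  have hzero : ∀ g, ∫ ω in H ⁻¹' {g}, f ω ∂P = 0 := by
    intro g
    have hcyl : H ⁻¹' {g} = {ω | ∀ i ≤ n, X i ω = g (Fin.ofNat (n + 1) i)} := by
      ext ω
      exact history_eq_iff n g ω
    have hms := measurableSet_cylinder hX n fun i => g (Fin.ofNat (n + 1) i)
    set s := g (Fin.ofNat (n + 1) n) with hs
    have h1 : ∫ ω in H ⁻¹' {g}, f ω ∂P =
        ∫ ω in H ⁻¹' {g}, h g * (Δ s (X (n + 1) ω) - D s) ∂P := by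
      refine setIntegral_congr_fun (hHm (measurableSet_singleton g)) fun ω hω => ?_
      have h2 := (history_eq_iff n g ω).1 hω n le_rfl
      have h3 : H ω = g := hω
      simp only [hf]
      rw [h3, h2]
    rw [h1, integral_const_mul, integral_sub, hcyl,
      setIntegral_cylinder hX hp hstep (hΔ s) n (fun i => g (Fin.ofNat (n + 1) i)) (hD s),
      setIntegral_const, smul_eq_mul, sub_self, mul_zero]
    · exact Integrable.of_bound
        ((measurable_of_countable (Δ s)).comp (hX (n + 1))).aestronglyMeasurable C
        (Eventually.of_forall fun ω => hΔ _ _)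
    · exact integrable_const _
  simp only [hzero]
  exact hasSum_zero

/-- A law of large numbers for bounded functionals of the steps of a countable Markov chain: they
average to their conditional means. -/
theorem ae_tendsto_average_step_sub_mean (hX : ∀ n, Measurable (X n)) (hp : ∀ s t, 0 ≤ p s t)
    (hstep : ∀ (n : ℕ) (g : ℕ → S), P {ω | ∀ i ≤ n + 1, X i ω = g i} =
      P {ω | ∀ i ≤ n, X i ω = g i} * ENNReal.ofReal (p (g n) (g (n + 1))))
    {Δ : S → S → ℝ} {D : S → ℝ} {C : ℝ} (hΔ : ∀ s t, |Δ s t| ≤ C)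
    (hD : ∀ s, HasSum (fun t => p s t * Δ s t) (D s)) (hDC : ∀ s, |D s| ≤ C) :
    ∀ᵐ ω ∂P, Tendsto (fun n : ℕ =>
      (∑ i ∈ Finset.range n, (Δ (X i ω) (X (i + 1) ω) - D (X i ω))) / n) atTop (𝓝 0) := by
  set ξ : ℕ → Ω → ℝ := fun i ω => Δ (X i ω) (X (i + 1) ω) - D (X i ω) with hξ
  have hξm : ∀ i, Measurable (ξ i) := fun i => by
    refine Measurable.sub ?_ ?_
    · exact (measurable_of_countable (Function.uncurry Δ)).comp ((hX i).prodMk (hX (i + 1)))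
    · exact (measurable_of_countable D).comp (hX i)
  have hξb : ∀ i ω, |ξ i ω| ≤ C + C := fun i ω =>
    (abs_sub _ _).trans (add_le_add (hΔ _ _) (hDC _))
  set M : ℕ → Ω → ℝ := fun n ω => ∑ i ∈ Finset.range n, ξ i ω with hM
  have hMm : ∀ n, Measurable (M n) := fun n => Finset.measurable_fun_sum _ fun i _ => hξm i
  have hMsucc : ∀ n ω, M (n + 1) ω = M n ω + ξ n ω := fun n ω => Finset.sum_range_succ _ _
  have hMb : ∀ n ω, |M n ω| ≤ n * (C + C) := fun n ω => by
    refine (Finset.abs_sum_le_sum_abs _ _).trans ?_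
    refine (Finset.sum_le_card_nsmul _ _ _ fun i _ => hξb i ω).trans (le_of_eq ?_)
    simp only [Finset.card_range, nsmul_eq_mul]
  have hint : ∀ n, Integrable (fun ω => M n ω ^ 2) P := fun n => by
    refine Integrable.of_bound ((hMm n).pow_const 2).aestronglyMeasurable ((n * (C + C)) ^ 2)
      (Eventually.of_forall fun ω => ?_)
    rw [Real.norm_eq_abs, abs_pow]
    exact pow_le_pow_left₀ (abs_nonneg _) (hMb n ω) 2
  have hξint : ∀ n, Integrable (fun ω => ξ n ω ^ 2) P := fun n => by
    refine Integrable.of_bound ((hξm n).pow_const 2).aestronglyMeasurable ((C + C) ^ 2)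
      (Eventually.of_forall fun ω => ?_)
    rw [Real.norm_eq_abs, abs_pow]
    exact pow_le_pow_left₀ (abs_nonneg _) (hξb n ω) 2
  have hMξint : ∀ n, Integrable (fun ω => M n ω * ξ n ω) P := fun n => by
    refine Integrable.of_bound ((hMm n).mul (hξm n)).aestronglyMeasurable
      (n * (C + C) * (C + C)) (Eventually.of_forall fun ω => ?_)
    rw [Real.norm_eq_abs, abs_mul]
    exact mul_le_mul (hMb n ω) (hξb n ω) (abs_nonneg _) ((abs_nonneg _).trans (hMb n ω))
  -- `M n` depends only on the history up to time `n`; without cross terms the second moment of `M`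
  -- grows at most linearly.
  have horth : ∀ n, ∫ ω, M n ω * ξ n ω ∂P = 0 := fun n => by
    set h : (Fin (n + 1) → S) → ℝ := fun g => ∑ i ∈ Finset.range n,
      (Δ (g (Fin.ofNat _ i)) (g (Fin.ofNat _ (i + 1))) - D (g (Fin.ofNat _ i))) with hh
    have hhb : ∀ g, |h g| ≤ n * (C + C) := fun g => by
      refine (Finset.abs_sum_le_sum_abs _ _).trans ?_
      refine (Finset.sum_le_card_nsmul _ _ _ fun i _ =>
        (abs_sub _ _).trans (add_le_add (hΔ _ _) (hDC _))).trans (le_of_eq ?_)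
      simp only [Finset.card_range, nsmul_eq_mul]
    rw [← integral_history_mul_eq_zero hX hp hstep hΔ hD hDC n hhb]
    refine integral_congr_ae (Eventually.of_forall fun ω => ?_)
    have h1 := (history_eq_iff (X := X) n (fun i => X i ω) ω).1 rfl
    simp only [hM, hh]
    congr 1
    refine Finset.sum_congr rfl fun i hi => ?_
    have hi' := Finset.mem_range.1 hi
    rw [← h1 i (by omega), ← h1 (i + 1) (by omega)]
  have hsq : ∀ n : ℕ, ∫ ω, M n ω ^ 2 ∂P ≤ (C + C) ^ 2 * n := by
    intro n
    induction n with
    | zero => simp [hM]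
    | succ n ih =>
      have h1 : ∀ ω, M (n + 1) ω ^ 2 = M n ω ^ 2 + 2 * (M n ω * ξ n ω) + ξ n ω ^ 2 := fun ω => by
        rw [hMsucc]
        ring
      simp only [h1]
      have hi : Integrable (fun ω => M n ω ^ 2 + 2 * (M n ω * ξ n ω)) P :=
        (hint n).add ((hMξint n).const_mul 2)
      rw [integral_add hi (hξint n),
        integral_add (hint n) ((hMξint n).const_mul 2), integral_const_mul, horth]
      have h2 : ∫ ω, ξ n ω ^ 2 ∂P ≤ (C + C) ^ 2 := by
        have := integral_mono (hξint n) (integrable_const ((C + C) ^ 2)) fun ω => by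
          have := pow_le_pow_left₀ (abs_nonneg _) (hξb n ω) 2
          rwa [sq_abs] at this
        simpa using this
      push_cast
      linarith
  have hMB : ∀ n ω, |M (n + 1) ω - M n ω| ≤ C + C := fun n ω => by
    rw [hMsucc, add_sub_cancel_left]
    exact hξb n ω
  exact ae_tendsto_div_of_integral_sq_le hMm hMB hint hsq

end Chain

/-! ### Moments of multinomial edge counts. -/

section Multinomial

variable {ι : Type*} [DecidableEq ι] {r : ℕ}

/-- The number of edges of `t` that point to `v`. -/
def linkCount (t : Fin r → ι) (v : ι) : ℕ :=
  (Finset.univ.filter fun i => t i = v).card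

theorem linkCount_eq_sum (t : Fin r → ι) (v : ι) :
    (linkCount t v : ℝ) = ∑ i, if t i = v then 1 else 0 := by
  rw [Finset.sum_boole]
  rfl

variable [Fintype ι]

theorem sum_linkCount (t : Fin r → ι) : ∑ v, linkCount t v = r := by
  unfold linkCount
  rw [← Finset.card_eq_sum_card_fiberwise fun i _ => Finset.mem_univ _]
  simp

theorem sum_prod_weights {ι : Type*} [Fintype ι] {r : ℕ} (p : ι → ℝ) :
    ∑ t : Fin r → ι, ∏ i, p (t i) = (∑ v, p v) ^ r := by
  have := Finset.prod_univ_sum (fun _ : Fin r => (Finset.univ : Finset ι)) fun _ v => p v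
  rw [Fintype.piFinset_univ] at this
  rw [← this]
  simp

/-- The probability that all edges in `s` point to `v`. -/
theorem sum_prod_weights_mul_indicator {p : ι → ℝ} (hp : ∑ v, p v = 1) (v : ι)
    (s : Finset (Fin r)) :
    ∑ t : Fin r → ι, (∏ i, p (t i)) * ∏ i ∈ s, (if t i = v then 1 else 0) = p v ^ s.card := by
  have h := Finset.prod_univ_sum (fun _ : Fin r => (Finset.univ : Finset ι))
    fun i w => p w * if i ∈ s then (if w = v then 1 else 0) else 1
  rw [Fintype.piFinset_univ] at h
  have h1 : ∀ i : Fin r, ∑ w, p w * (if i ∈ s then (if w = v then 1 else 0) else 1) =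
      if i ∈ s then p v else 1 := by
    intro i
    split_ifs <;> simp [hp]
  simp only [h1, Finset.prod_mul_distrib, Finset.prod_ite_mem, Finset.univ_inter,
    Finset.prod_const] at h
  exact h.symm

theorem sum_prod_weights_mul_linkCount {p : ι → ℝ} (hp : ∑ v, p v = 1) (v : ι) :
    ∑ t : Fin r → ι, (∏ i, p (t i)) * linkCount t v = r * p v := by
  simp only [linkCount_eq_sum, Finset.mul_sum]
  rw [Finset.sum_comm]
  have h : ∀ i : Fin r, ∑ t : Fin r → ι, (∏ i, p (t i)) * (if t i = v then 1 else 0) = p v := by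
    intro i
    simpa using sum_prod_weights_mul_indicator hp v {i}
  simp only [h, Finset.sum_const, Finset.card_univ, Fintype.card_fin, nsmul_eq_mul]

/-- The factorial moment counts ordered pairs of distinct edges that both hit `v`, each with
probability `p v ^ 2`. It will control multiple hits of one vertex. -/
theorem sum_prod_weights_mul_linkCount_sub_one {p : ι → ℝ} (hp : ∑ v, p v = 1) (v : ι) :
    ∑ t : Fin r → ι, (∏ i, p (t i)) * (linkCount t v * (linkCount t v - 1)) =
      r * (r - 1) * p v ^ 2 := by
  have h1 : ∀ t : Fin r → ι, (linkCount t v * (linkCount t v - 1) : ℝ) =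
      ∑ i, ∑ j ∈ Finset.univ.erase i, ∏ l ∈ {i, j}, (if t l = v then 1 else 0) := by
    intro t
    have h2 : ∀ i, ∑ j ∈ Finset.univ.erase i, ∏ l ∈ {i, j}, (if t l = v then (1 : ℝ) else 0) =
        (if t i = v then 1 else 0) * ((∑ j, if t j = v then 1 else 0) - 1) := by
      intro i
      have h3 : ∀ j ∈ Finset.univ.erase i, ∏ l ∈ {i, j}, (if t l = v then (1 : ℝ) else 0) =
          (if t i = v then 1 else 0) * (if t j = v then 1 else 0) := fun j hj =>
        Finset.prod_pair (Finset.ne_of_mem_erase hj).symm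
      rw [Finset.sum_congr rfl h3, ← Finset.mul_sum,
        Finset.sum_erase_eq_sub (Finset.mem_univ i)]
      split_ifs <;> simp
    simp only [h2]
    rw [← Finset.sum_mul, ← linkCount_eq_sum]
  simp only [h1, Finset.mul_sum]
  rw [Finset.sum_comm]
  have h4 : ∀ i : Fin r, ∑ t : Fin r → ι, ∑ j ∈ Finset.univ.erase i,
      (∏ i, p (t i)) * ∏ l ∈ {i, j}, (if t l = v then 1 else 0) = (r - 1) * p v ^ 2 := by
    intro i
    have hr : 1 ≤ r := i.pos
    rw [Finset.sum_comm]
    have h5 : ∀ j ∈ Finset.univ.erase i, ∑ t : Fin r → ι,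
        (∏ i, p (t i)) * ∏ l ∈ {i, j}, (if t l = v then 1 else 0) = p v ^ 2 := by
      intro j hj
      rw [sum_prod_weights_mul_indicator hp, Finset.card_pair (Finset.ne_of_mem_erase hj).symm]
    rw [Finset.sum_congr rfl h5, Finset.sum_const, Finset.card_erase_of_mem (Finset.mem_univ i),
      nsmul_eq_mul, Finset.card_univ, Fintype.card_fin, Nat.cast_sub hr, Nat.cast_one]
  simp only [h4, Finset.sum_const, Finset.card_univ, Fintype.card_fin, nsmul_eq_mul]
  ring

end Multinomial

/-! ### Degrees under attachment of a vertex. -/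

namespace Network

variable {K : ℕ}

instance : Countable (Network K) := by
  have : Function.Injective fun G : Network K =>
      (⟨G.size, G.attr, G.edges⟩ : Σ n, (Fin n → Fin K) × Multiset (Fin n × Fin n)) := by
    rintro ⟨n, a, e⟩ ⟨n', a', e'⟩ h
    simp only [Sigma.mk.injEq] at h
    obtain ⟨rfl, h⟩ := h
    simp only [heq_eq_eq, Prod.mk.injEq] at h
    obtain ⟨rfl, rfl⟩ := h
    rfl
  exact this.countable

/-- The edges of a graph on `n` vertices, together with edges from a new vertex to the `t i`. -/
def attachEdges {n r : ℕ} (E : Multiset (Fin n × Fin n)) (t : Fin r → Fin n) :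
    Multiset (Fin (n + 1) × Fin (n + 1)) :=
  E.map (Prod.map Fin.castSucc Fin.castSucc) +
    Finset.univ.val.map fun i => (Fin.last n, (t i).castSucc)

section AttachEdges

variable {n r : ℕ} (E : Multiset (Fin n × Fin n)) (t : Fin r → Fin n)

theorem map_fst_attachEdges : (attachEdges E t).map Prod.fst =
    (E.map Prod.fst).map Fin.castSucc + Multiset.replicate r (Fin.last n) := by
  simp [attachEdges, Multiset.map_map, Function.comp_def, ← Multiset.coe_replicate]

theorem map_snd_attachEdges : (attachEdges E t).map Prod.snd =
    (E.map Prod.snd).map Fin.castSucc + (Finset.univ.val.map t).map Fin.castSucc := by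
  simp [attachEdges, Multiset.map_map, Function.comp_def]

theorem count_map_castSucc_last (s : Multiset (Fin n)) :
    (s.map Fin.castSucc).count (Fin.last n) = 0 := by
  simp [Fin.castSucc_ne_last]

theorem count_map_univ_eq_linkCount (v : Fin n) :
    (Finset.univ.val.map t).count v = linkCount t v := by
  rw [Multiset.count_map, linkCount, Finset.card_def, Finset.filter_val]
  congr 1
  exact Multiset.filter_congr fun i _ => eq_comm

end AttachEdges

theorem deg_attach_castSucc (G₀ G : Network K) (b : Fin K) {r : ℕ} (t : Fin r → Fin G.size)
    (v : Fin G.size) :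
    deg G₀ (G.attach b t) v.castSucc = deg G₀ G v + linkCount t v := by
  change ((attachEdges G.edges t).map Prod.fst).count v.castSucc +
    ((attachEdges G.edges t).map Prod.snd).count v.castSucc +
    (if G₀.size = 1 ∧ G₀.edges = 0 ∧ (v : ℕ) = 0 then 1 else 0) = _
  have h : Multiset.count v.castSucc (Multiset.replicate r (Fin.last G.size)) = 0 := by
    rw [Multiset.count_replicate, if_neg (Fin.castSucc_ne_last v).symm]
  rw [map_fst_attachEdges, map_snd_attachEdges, Multiset.count_add, Multiset.count_add, h,
    Multiset.count_map_eq_count' _ _ (Fin.castSucc_injective _),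
    Multiset.count_map_eq_count' _ _ (Fin.castSucc_injective _),
    Multiset.count_map_eq_count' _ _ (Fin.castSucc_injective _), count_map_univ_eq_linkCount]
  unfold deg
  ring

/-- Positive size ensures that the new vertex is not number 0, which may carry the extra initial
degree. -/
theorem deg_attach_last {G₀ G : Network K} (hG : 0 < G.size) (b : Fin K) {r : ℕ}
    (t : Fin r → Fin G.size) :
    deg G₀ (G.attach b t) (Fin.last G.size) = r := by
  change ((attachEdges G.edges t).map Prod.fst).count (Fin.last G.size) +
    ((attachEdges G.edges t).map Prod.snd).count (Fin.last G.size) +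
    (if G₀.size = 1 ∧ G₀.edges = 0 ∧ G.size = 0 then 1 else 0) = _
  rw [map_fst_attachEdges, map_snd_attachEdges, Multiset.count_add, Multiset.count_add,
    count_map_castSucc_last, count_map_castSucc_last, count_map_castSucc_last,
    Multiset.count_replicate_self]
  simp [hG.ne']

/-- The sum of a function of attribute and degree over all vertices. -/
noncomputable def vertexSum (G₀ G : Network K) (g : Fin K → ℕ → ℝ) : ℝ :=
  ∑ v, g (G.attr v) (deg G₀ G v)

theorem vertexSum_attach {G₀ G : Network K} (hG : 0 < G.size) (b : Fin K) {r : ℕ}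
    (t : Fin r → Fin G.size) (g : Fin K → ℕ → ℝ) :
    vertexSum G₀ (G.attach b t) g =
      ∑ v, g (G.attr v) (deg G₀ G v + linkCount t v) + g b r := by
  refine (Fin.sum_univ_castSucc (n := G.size)
    (fun v => g ((G.attach b t).attr v) (deg G₀ (G.attach b t) v))).trans ?_
  rw [deg_attach_last hG]
  congr 1
  · refine Finset.sum_congr rfl fun v _ => ?_
    rw [deg_attach_castSucc]
    simp [attach]
  · simp [attach]

theorem vertexSum_attach_sub {G₀ G : Network K} (hG : 0 < G.size) (b : Fin K) {r : ℕ}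
    (t : Fin r → Fin G.size) (g : Fin K → ℕ → ℝ) :
    vertexSum G₀ (G.attach b t) g - vertexSum G₀ G g =
      ∑ v, (g (G.attr v) (deg G₀ G v + linkCount t v) - g (G.attr v) (deg G₀ G v)) + g b r := by
  rw [vertexSum_attach hG, vertexSum, Finset.sum_sub_distrib]
  ring

/-- Only `r` edge ends land on old vertices, so a summand that is 1-Lipschitz in the degree has
increments bounded independently of the size of the network. -/
theorem abs_vertexSum_attach_sub_le {G₀ G : Network K} (hG : 0 < G.size) (b : Fin K) {r : ℕ}
    (t : Fin r → Fin G.size) {g : Fin K → ℕ → ℝ} (hg : ∀ c d x, |g c (d + x) - g c d| ≤ (x : ℝ))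
    (hgr : |g b r| ≤ r) :
    |vertexSum G₀ (G.attach b t) g - vertexSum G₀ G g| ≤ 2 * r := by
  rw [vertexSum_attach_sub hG]
  have h1 : ∑ v, |g (G.attr v) (deg G₀ G v + linkCount t v) - g (G.attr v) (deg G₀ G v)| ≤ r := by
    refine (Finset.sum_le_sum fun v _ => hg _ _ _).trans (le_of_eq ?_)
    exact_mod_cast sum_linkCount t
  have h2 := Finset.abs_sum_le_sum_abs (fun v =>
    g (G.attr v) (deg G₀ G v + linkCount t v) - g (G.attr v) (deg G₀ G v)) Finset.univ
  refine (abs_add_le _ _).trans ?_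
  linarith

/-- The total degree of the vertices of attribute `a`. -/
noncomputable def totalDeg (G₀ G : Network K) (a : Fin K) : ℝ :=
  vertexSum G₀ G fun c d => if c = a then (d : ℝ) else 0

theorem totalDeg_nonneg (G₀ G : Network K) (a : Fin K) : 0 ≤ totalDeg G₀ G a := by
  unfold totalDeg vertexSum
  exact Finset.sum_nonneg fun v _ => by beta_reduce; split_ifs <;> positivity

theorem sum_kernel_mul_deg (κ : Fin K → Fin K → ℝ) (G₀ G : Network K) (b : Fin K) :
    ∑ w, κ (G.attr w) b * (deg G₀ G w : ℝ) = ∑ l, totalDeg G₀ G l * κ l b := by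
  simp only [totalDeg, vertexSum, Finset.sum_mul]
  rw [Finset.sum_comm]
  refine Finset.sum_congr rfl fun w _ => ?_
  simp [mul_comm]

/-- The graph has a vertex of positive degree. -/
def HasPosDeg (G₀ G : Network K) : Prop :=
  ∃ v, 0 < deg G₀ G v

theorem HasPosDeg.size_pos {G₀ G : Network K} (h : HasPosDeg G₀ G) : 0 < G.size :=
  let ⟨v, _⟩ := h
  v.pos

theorem HasPosDeg.attach {G₀ G : Network K} (h : HasPosDeg G₀ G) (b : Fin K) {r : ℕ}
    (t : Fin r → Fin G.size) : HasPosDeg G₀ (G.attach b t) := by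
  obtain ⟨v, hv⟩ := h
  refine ⟨v.castSucc, ?_⟩
  rw [deg_attach_castSucc]
  omega

/-- A connected graph without edges is a single vertex, whose degree is initialized to one; so the
attachment weights never degenerate to `0 / 0`. -/
theorem Connected.hasPosDeg {G : Network K} (h : G.Connected) : HasPosDeg G G := by
  unfold Connected at h
  by_cases he : G.edges = 0
  · have hbot : (SimpleGraph.fromRel fun u v => (u, v) ∈ G.edges) = ⊥ := by
      ext u v
      simp [he]
    rw [hbot] at h
    have hs : Subsingleton (Fin G.size) := SimpleGraph.preconnected_bot_iff_subsingleton.1 h.preconnected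
    obtain ⟨v⟩ := h.nonempty
    have h1 : G.size = 1 := by
      have := Fintype.card_le_one_iff_subsingleton.2 hs
      rw [Fintype.card_fin] at this
      have := v.pos
      omega
    refine ⟨v, ?_⟩
    have hv : (v : ℕ) = 0 := by omega
    simp [deg, h1, he, hv]
  · obtain ⟨e, he⟩ := Multiset.exists_mem_of_ne_zero he
    refine ⟨e.1, ?_⟩
    have : 0 < (G.edges.map Prod.fst).count e.1 :=
      Multiset.count_pos.2 (Multiset.mem_map_of_mem _ he)
    unfold deg
    omega

theorem sum_kernel_mul_deg_pos {κ : Fin K → Fin K → ℝ} (hκ : ∀ a b, 0 < κ a b)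
    {G₀ G : Network K} (h : HasPosDeg G₀ G) (b : Fin K) :
    0 < ∑ w, κ (G.attr w) b * (deg G₀ G w : ℝ) := by
  obtain ⟨v, hv⟩ := h
  refine Finset.sum_pos' (fun w _ => mul_nonneg (hκ _ _).le (Nat.cast_nonneg _)) ⟨v, Finset.mem_univ v, ?_⟩
  exact mul_pos (hκ _ _) (by exact_mod_cast hv)

end Network

open Network

/-! ### Conditional expectations of one-step increments. -/

section Drift

variable {K : ℕ} {π : Fin K → ℝ} {κ : Fin K → Fin K → ℝ} {m : Fin K → ℕ} {G₀ G : Network K}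

theorem edgeProb_nonneg (hκ : ∀ a b, 0 < κ a b) (b : Fin K) (v : Fin G.size) :
    0 ≤ edgeProb κ G₀ G b v :=
  div_nonneg (mul_nonneg (hκ _ _).le (Nat.cast_nonneg _))
    (Finset.sum_nonneg fun _ _ => mul_nonneg (hκ _ _).le (Nat.cast_nonneg _))

/-- Valid also when the normaliser vanishes and all quotients are 0; this gives drift bounds on
every state, reachable or not. -/
theorem sum_edgeProb_le_one (b : Fin K) : ∑ v, edgeProb κ G₀ G b v ≤ 1 := by
  unfold edgeProb
  rw [← Finset.sum_div]
  exact div_self_le_one _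

theorem sum_edgeProb (hκ : ∀ a b, 0 < κ a b) (hG : HasPosDeg G₀ G) (b : Fin K) :
    ∑ v, edgeProb κ G₀ G b v = 1 := by
  unfold edgeProb
  rw [← Finset.sum_div]
  exact div_self (sum_kernel_mul_deg_pos hκ hG b).ne'

variable (π κ m G₀ G) in
/-- The conditional expectation of a function of the attribute and of the edges of the next
vertex. -/
noncomputable def expectedStep (F : ∀ b : Fin K, (Fin (m b) → Fin G.size) → ℝ) : ℝ :=
  ∑ b, π b * ∑ t, (∏ i, edgeProb κ G₀ G b (t i)) * F b t

variable (π κ m G₀) in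
/-- The expected increment of `f` in the next step. -/
noncomputable def drift (f : Network K → ℝ) (G : Network K) : ℝ :=
  expectedStep π κ m G₀ G fun b t => f (G.attach b t) - f G

theorem abs_expectedStep_le (hπ : ∀ a, 0 < π a) (hκ : ∀ a b, 0 < κ a b)
    {F F' : ∀ b : Fin K, (Fin (m b) → Fin G.size) → ℝ} (h : ∀ b t, |F b t| ≤ F' b t) :
    |expectedStep π κ m G₀ G F| ≤ expectedStep π κ m G₀ G F' := by
  unfold expectedStep
  refine (Finset.abs_sum_le_sum_abs _ _).trans (Finset.sum_le_sum fun b _ => ?_)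
  rw [abs_mul, abs_of_pos (hπ b)]
  refine mul_le_mul_of_nonneg_left ?_ (hπ b).le
  refine (Finset.abs_sum_le_sum_abs _ _).trans (Finset.sum_le_sum fun t _ => ?_)
  have h1 : 0 ≤ ∏ i, edgeProb κ G₀ G b (t i) :=
    Finset.prod_nonneg fun i _ => edgeProb_nonneg hκ _ _
  rw [abs_mul, abs_of_nonneg h1]
  exact mul_le_mul_of_nonneg_left (h b t) h1

theorem expectedStep_const_le (hπ : ∀ a, 0 < π a) (hπs : ∑ a, π a = 1) (hκ : ∀ a b, 0 < κ a b)
    {C : ℝ} (hC : 0 ≤ C) : expectedStep π κ m G₀ G (fun _ _ => C) ≤ C := by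
  unfold expectedStep
  have h : ∀ b ∈ Finset.univ, π b * ∑ t : Fin (m b) → Fin G.size,
      (∏ i, edgeProb κ G₀ G b (t i)) * C ≤ π b * C := by
    intro b _
    rw [← Finset.sum_mul, sum_prod_weights]
    refine mul_le_mul_of_nonneg_left (mul_le_of_le_one_left hC ?_) (hπ b).le
    exact pow_le_one₀ (Finset.sum_nonneg fun v _ => edgeProb_nonneg hκ _ _)
      (sum_edgeProb_le_one b)
  refine (Finset.sum_le_sum h).trans (le_of_eq ?_)
  rw [← Finset.sum_mul, hπs, one_mul]

theorem expectedStep_sub (F F' : ∀ b : Fin K, (Fin (m b) → Fin G.size) → ℝ) :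
    expectedStep π κ m G₀ G F - expectedStep π κ m G₀ G F' =
      expectedStep π κ m G₀ G fun b t => F b t - F' b t := by
  simp only [expectedStep, mul_sub, Finset.sum_sub_distrib]

/-- A vertex receives on average its degree times the attachment rate of its attribute, because the
normaliser depends on the network only through the total degrees. All drifts reduce to this formula.
-/
theorem expectedStep_linkCount (hκ : ∀ a b, 0 < κ a b) (hG : HasPosDeg G₀ G)
    (W : Fin G.size → ℝ) (e : Fin K → ℝ) :
    expectedStep π κ m G₀ G (fun b t => ∑ v, W v * linkCount t v + e b) =
      ∑ v, W v * deg G₀ G v * attachRate π κ m (totalDeg G₀ G) (G.attr v) + ∑ b, π b * e b := by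
  unfold expectedStep attachRate
  simp only [mul_add, Finset.sum_add_distrib, ← Finset.sum_mul, sum_prod_weights,
    sum_edgeProb hκ hG, one_pow, one_mul]
  congr 1
  simp only [Finset.mul_sum]
  conv_rhs => rw [Finset.sum_comm]
  refine Finset.sum_congr rfl fun b _ => ?_
  rw [Finset.sum_comm]
  refine Finset.sum_congr rfl fun v _ => ?_
  have h := sum_prod_weights_mul_linkCount (r := m b) (sum_edgeProb hκ hG b) v
  have h1 : ∑ t : Fin (m b) → Fin G.size,
      π b * ((∏ i, edgeProb κ G₀ G b (t i)) * (W v * linkCount t v)) =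
      π b * W v * (m b * edgeProb κ G₀ G b v) := by
    rw [← h, Finset.mul_sum]
    exact Finset.sum_congr rfl fun t _ => by ring
  rw [h1, edgeProb, sum_kernel_mul_deg]
  ring

theorem expectedStep_linkCount_sq (hκ : ∀ a b, 0 < κ a b) (hG : HasPosDeg G₀ G)
    (U : Fin G.size → ℝ) :
    expectedStep π κ m G₀ G
      (fun _ t => ∑ v, U v * ((linkCount t v : ℝ) * ((linkCount t v : ℝ) - 1))) =
      ∑ b, π b * ∑ v, U v * ((m b : ℝ) * ((m b : ℝ) - 1) * edgeProb κ G₀ G b v ^ 2) := by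
  unfold expectedStep
  refine Finset.sum_congr rfl fun b _ => ?_
  congr 1
  simp only [Finset.mul_sum]
  rw [Finset.sum_comm]
  refine Finset.sum_congr rfl fun v _ => ?_
  rw [← sum_prod_weights_mul_linkCount_sub_one (sum_edgeProb hκ hG b) v, Finset.mul_sum]
  exact Finset.sum_congr rfl fun t _ => by ring

/-- The number of vertices of attribute `a`. -/
noncomputable def attrCount (G₀ G : Network K) (a : Fin K) : ℝ :=
  vertexSum G₀ G fun c _ => if c = a then 1 else 0

/-- The number of vertices of attribute `a` and degree `k`. -/
noncomputable def degCount (G₀ G : Network K) (a : Fin K) (k : ℕ) : ℝ :=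
  vertexSum G₀ G fun c d => if c = a ∧ d = k then 1 else 0

/-- The total degree of the vertices of attribute `a` and degree `k - 1`. -/
noncomputable def predDeg (G₀ G : Network K) (a : Fin K) (k : ℕ) : ℝ :=
  vertexSum G₀ G fun c d => if c = a ∧ d + 1 = k then (d : ℝ) else 0

theorem predDeg_zero (a : Fin K) : predDeg G₀ G a 0 = 0 := by
  simp [predDeg, vertexSum]

theorem predDeg_succ (a : Fin K) (k : ℕ) : predDeg G₀ G a (k + 1) = k * degCount G₀ G a k := by
  simp only [predDeg, degCount, vertexSum, Finset.mul_sum]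
  refine Finset.sum_congr rfl fun v _ => ?_
  by_cases h : G.attr v = a ∧ deg G₀ G v = k
  · simp [h]
  · simp [h]

theorem degFraction_eq (a : Fin K) (k : ℕ) :
    degFraction G₀ G a k = degCount G₀ G a k / attrCount G₀ G a := by
  simp only [degFraction, degCount, attrCount, vertexSum, Finset.sum_boole]

theorem degCount_nonneg (a : Fin K) (k : ℕ) : 0 ≤ degCount G₀ G a k := by
  unfold degCount vertexSum
  exact Finset.sum_nonneg fun v _ => by beta_reduce; split_ifs <;> norm_num

theorem degCount_le (a : Fin K) (k : ℕ) : degCount G₀ G a k ≤ G.size := by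
  unfold degCount vertexSum
  refine (Finset.sum_le_card_nsmul _ _ 1 fun v _ => by beta_reduce; split_ifs <;> norm_num).trans ?_
  simp

theorem drift_attrCount (hκ : ∀ a b, 0 < κ a b) (hG : HasPosDeg G₀ G) (a : Fin K) :
    drift π κ m G₀ (fun H => attrCount G₀ H a) G = π a := by
  have h := expectedStep_linkCount (π := π) (m := m) hκ hG (fun _ => 0)
    fun b => if b = a then 1 else 0
  simp only [zero_mul, Finset.sum_const_zero, zero_add, mul_ite, mul_one, mul_zero,
    Finset.sum_ite_eq', Finset.mem_univ, if_true] at h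
  rw [← h]
  unfold drift attrCount
  congr 1
  funext b t
  rw [vertexSum_attach_sub hG.size_pos]
  simp

theorem drift_totalDeg (hκ : ∀ a b, 0 < κ a b) (hG : HasPosDeg G₀ G) (a : Fin K) :
    drift π κ m G₀ (fun H => totalDeg G₀ H a) G = degreeDrift π κ m (totalDeg G₀ G) a := by
  have h := expectedStep_linkCount (π := π) (m := m) hκ hG
    (fun v => if G.attr v = a then 1 else 0) fun b => if b = a then (m b : ℝ) else 0
  have h1 : ∑ v, (if G.attr v = a then (1 : ℝ) else 0) * deg G₀ G v *
      attachRate π κ m (totalDeg G₀ G) (G.attr v) =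
      totalDeg G₀ G a * attachRate π κ m (totalDeg G₀ G) a := by
    rw [totalDeg, vertexSum, Finset.sum_mul]
    refine Finset.sum_congr rfl fun v _ => ?_
    by_cases hv : G.attr v = a
    · simp only [hv, if_true, one_mul]
    · simp [hv]
  have h2 : degreeDrift π κ m (totalDeg G₀ G) a = totalDeg G₀ G a *
      attachRate π κ m (totalDeg G₀ G) a + ∑ b, π b * (if b = a then (m b : ℝ) else 0) := by
    simp only [degreeDrift, mul_ite, mul_zero, Finset.sum_ite_eq', Finset.mem_univ, if_true]
    ring
  rw [h2, ← h1, ← h]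
  unfold drift totalDeg
  congr 1
  funext b t
  rw [vertexSum_attach_sub hG.size_pos]
  congr 1
  refine Finset.sum_congr rfl fun v _ => ?_
  split_ifs <;> simp

/-- Linearising the change of the indicator in the number `x` of new edges is exact for `x ≤ 1`, and
`x * (x - 1)` pays for the rest. Degrees only grow, so nothing happens for `d > k`; the restriction
to `d ≤ k` is what makes the hitting probabilities small. -/
theorem abs_indicator_add_sub_le (d x k : ℕ) :
    |((if d + x = k then (1 : ℝ) else 0) - if d = k then 1 else 0) -
      ((if d + 1 = k then (1 : ℝ) else 0) - if d = k then 1 else 0) * x| ≤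
      (if d ≤ k then 1 else 0) * ((x : ℝ) * ((x : ℝ) - 1)) := by
  rcases Nat.lt_or_ge x 2 with hx | hx
  · interval_cases x <;> simp
  · have hx' : (2 : ℝ) ≤ x := by exact_mod_cast hx
    rw [abs_le]
    by_cases h1 : d ≤ k
    · rw [if_pos h1]
      by_cases h2 : d = k
      · rw [if_neg (by omega), if_pos h2, if_neg (by omega)]
        constructor <;> nlinarith
      · rw [if_neg h2]
        by_cases h3 : d + 1 = k
        · rw [if_neg (by omega), if_pos h3]
          constructor <;> nlinarith
        · rw [if_neg h3]
          split_ifs <;> constructor <;> nlinarith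
    · rw [if_neg h1, if_neg (by omega), if_neg (by omega), if_neg (by omega)]
      simp

/-- The linearised part is births plus inflow minus outflow. The error is a second factorial moment
over vertices of degree at most `k`, each hit with probability at most a constant over the
normaliser; it is of order `size / n ^ 2` once the total degrees grow linearly. -/
theorem abs_drift_degCount_sub_le (hπ : ∀ a, 0 < π a) (hκ : ∀ a b, 0 < κ a b)
    (hG : HasPosDeg G₀ G) (a : Fin K) (k : ℕ) :
    |drift π κ m G₀ (fun H => degCount G₀ H a k) G -
      ((if m a = k then π a else 0) + attachRate π κ m (totalDeg G₀ G) a *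
        (predDeg G₀ G a k - k * degCount G₀ G a k))| ≤
    ∑ b, π b * ((m b : ℝ) ^ 2 * (G.size *
      ((∑ c, κ c b) * k / ∑ l, totalDeg G₀ G l * κ l b) ^ 2)) := by
  set W : Fin G.size → ℝ := fun v => if G.attr v = a then
    ((if deg G₀ G v + 1 = k then (1 : ℝ) else 0) - if deg G₀ G v = k then 1 else 0) else 0 with hW
  set e : Fin K → ℝ := fun b => if b = a ∧ m b = k then 1 else 0 with he
  have hmain : (if m a = k then π a else 0) + attachRate π κ m (totalDeg G₀ G) a *
      (predDeg G₀ G a k - k * degCount G₀ G a k) =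
      expectedStep π κ m G₀ G fun b t => ∑ v, W v * linkCount t v + e b := by
    rw [expectedStep_linkCount hκ hG, add_comm]
    congr 1
    · rw [predDeg, degCount, vertexSum, vertexSum, Finset.mul_sum, ← Finset.sum_sub_distrib,
        Finset.mul_sum]
      refine Finset.sum_congr rfl fun v _ => ?_
      by_cases hv : G.attr v = a
      · simp only [hW, hv, if_true, true_and]
        by_cases h2 : deg G₀ G v = k
        · simp [h2]
          ring
        · simp [h2]
          ring_nf
      · simp [hW, hv]
    · have h3 : ∀ b, π b * e b = if b = a then (if m a = k then π a else 0) else 0 := by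
        intro b
        by_cases hb : b = a
        · subst hb
          simp [he]
        · simp [he, hb]
      simp [h3]
  rw [hmain, drift, expectedStep_sub]
  have hle : ∀ b (t : Fin (m b) → Fin G.size), |degCount G₀ (G.attach b t) a k -
      degCount G₀ G a k - (∑ v, W v * linkCount t v + e b)| ≤
      ∑ v, (if deg G₀ G v ≤ k then (1 : ℝ) else 0) *
        ((linkCount t v : ℝ) * ((linkCount t v : ℝ) - 1)) := by
    intro b t
    rw [degCount, degCount, vertexSum_attach_sub hG.size_pos, add_sub_add_comm,
      ← Finset.sum_sub_distrib]
    have h4 : ((if b = a ∧ m b = k then 1 else 0) - e b) = 0 := sub_self _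
    rw [h4, add_zero]
    refine (Finset.abs_sum_le_sum_abs _ _).trans (Finset.sum_le_sum fun v _ => ?_)
    have h5 := abs_indicator_add_sub_le (deg G₀ G v) (linkCount t v) k
    by_cases hv : G.attr v = a
    · simp only [hW, hv, true_and, if_true]
      exact h5
    · simp only [hW, hv, false_and, if_false, sub_self, zero_mul, abs_zero]
      exact (abs_nonneg _).trans h5
  refine (abs_expectedStep_le hπ hκ hle).trans ?_
  rw [expectedStep_linkCount_sq hκ hG]
  refine Finset.sum_le_sum fun b _ => mul_le_mul_of_nonneg_left ?_ (hπ b).le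
  have hL := sum_kernel_mul_deg_pos hκ hG b
  have hterm : ∀ v ∈ Finset.univ, (if deg G₀ G v ≤ k then (1 : ℝ) else 0) *
      ((m b : ℝ) * ((m b : ℝ) - 1) * edgeProb κ G₀ G b v ^ 2) ≤
      (m b : ℝ) ^ 2 * ((∑ c, κ c b) * k / ∑ l, totalDeg G₀ G l * κ l b) ^ 2 := by
    intro v _
    split_ifs with hv
    · have h6 : edgeProb κ G₀ G b v ≤ (∑ c, κ c b) * k / ∑ l, totalDeg G₀ G l * κ l b := by
        rw [edgeProb, ← sum_kernel_mul_deg]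
        gcongr
        · exact Finset.sum_nonneg fun c _ => (hκ c b).le
        · exact Finset.single_le_sum (f := fun c => κ c b) (fun c _ => (hκ c b).le)
            (Finset.mem_univ _)
      have h7 : edgeProb κ G₀ G b v ^ 2 ≤
          ((∑ c, κ c b) * k / ∑ l, totalDeg G₀ G l * κ l b) ^ 2 :=
        pow_le_pow_left₀ (edgeProb_nonneg hκ _ _) h6 2
      have h8 : (m b : ℝ) * ((m b : ℝ) - 1) ≤ (m b : ℝ) ^ 2 := by
        nlinarith [(Nat.cast_nonneg (m b) : (0 : ℝ) ≤ m b)]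
      rw [one_mul]
      exact (mul_le_mul_of_nonneg_right h8 (sq_nonneg _)).trans
        (mul_le_mul_of_nonneg_left h7 (sq_nonneg _))
    · rw [zero_mul]
      positivity
  refine (Finset.sum_le_card_nsmul _ _ _ hterm).trans (le_of_eq ?_)
  rw [Finset.card_univ, Fintype.card_fin, nsmul_eq_mul]
  ring

end Drift

/-! ### From the Markov chain to almost sure asymptotics. -/

section Transition

variable {K : ℕ} {π : Fin K → ℝ} {κ : Fin K → Fin K → ℝ} {m : Fin K → ℕ} {G₀ G : Network K}

theorem stepProb_nonneg (hπ : ∀ a, 0 < π a) (hκ : ∀ a b, 0 < κ a b) (H : Network K) :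
    0 ≤ stepProb π κ m G₀ G H := by
  unfold stepProb
  refine Finset.sum_nonneg fun b _ => mul_nonneg (hπ b).le (Finset.sum_nonneg fun t _ =>
    mul_nonneg (Finset.prod_nonneg fun i _ => edgeProb_nonneg hκ _ _) ?_)
  split_ifs <;> norm_num

theorem exists_attach_of_stepProb_ne_zero {H : Network K} (h : stepProb π κ m G₀ G H ≠ 0) :
    ∃ (b : Fin K) (t : Fin (m b) → Fin G.size), G.attach b t = H := by
  contrapose! h
  simp [stepProb, h]

theorem hasSum_stepProb_mul (f : Network K → ℝ) :
    HasSum (fun H => stepProb π κ m G₀ G H * f H)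
      (expectedStep π κ m G₀ G fun b t => f (G.attach b t)) := by
  classical
  have h : ∀ H, stepProb π κ m G₀ G H * f H = ∑ b, ∑ t : Fin (m b) → Fin G.size,
      if H = G.attach b t then
        π b * ((∏ i, edgeProb κ G₀ G b (t i)) * f (G.attach b t)) else 0 := by
    intro H
    simp only [stepProb, Finset.sum_mul, Finset.mul_sum]
    refine Finset.sum_congr rfl fun b _ => Finset.sum_congr rfl fun t _ => ?_
    by_cases ht : H = G.attach b t
    · simp [ht]
      ring
    · rw [if_neg (Ne.symm ht), if_neg ht]
      ring
  simp only [h, expectedStep, Finset.mul_sum]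
  exact hasSum_sum fun b _ => hasSum_sum fun t _ => hasSum_ite_eq _ _

theorem tendsto_div_sub_average {x d : ℕ → ℝ}
    (h : Tendsto (fun n : ℕ => (∑ i ∈ Finset.range n, (x (i + 1) - x i - d i)) / n) atTop (𝓝 0)) :
    Tendsto (fun n : ℕ => x n / n - (∑ i ∈ Finset.range n, d i) / n) atTop (𝓝 0) := by
  have h1 := h.add (tendsto_const_div_atTop_nhds_zero_nat (x 0))
  rw [add_zero] at h1
  refine h1.congr fun n => ?_
  rw [Finset.sum_sub_distrib, Finset.sum_range_sub]
  ring

end Transition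

section Path

variable {K : ℕ} {Ω : Type*} [MeasurableSpace Ω] {P : Measure Ω}
  {π : Fin K → ℝ} {κ : Fin K → Fin K → ℝ} {m : Fin K → ℕ} {G₀ : Network K}
  {G : ℕ → Ω → Network K}

theorem IsNetworkProcess.ae_exists_attach (hG : IsNetworkProcess P π κ m G₀ G) :
    ∀ᵐ ω ∂P, ∀ n, ∃ (b : Fin K) (t : Fin (m b) → Fin (G n ω).size),
      (G n ω).attach b t = G (n + 1) ω := by
  filter_upwards [ae_step_ne_zero hG.step] with ω hω n
  exact exists_attach_of_stepProb_ne_zero (hω n)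

/-- A functional of the network with bounded increments grows by its average drift. -/
theorem IsNetworkProcess.ae_tendsto_sub_drift [IsProbabilityMeasure P] (hπ : ∀ a, 0 < π a)
    (hπs : ∑ a, π a = 1) (hκ : ∀ a b, 0 < κ a b) (hG : IsNetworkProcess P π κ m G₀ G)
    {f : Network K → ℝ} {C : ℝ} (hC : 0 ≤ C)
    (hf : ∀ (H : Network K) b (t : Fin (m b) → Fin H.size), |f (H.attach b t) - f H| ≤ C) :
    ∀ᵐ ω ∂P, Tendsto (fun n : ℕ => f (G n ω) / n -
      (∑ i ∈ Finset.range n, drift π κ m G₀ f (G i ω)) / n) atTop (𝓝 0) := by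
  classical
  -- The chain law needs a bound for all pairs of states; the truncation provides it and changes
  -- nothing on pairs joined by an attachment.
  set Δ : Network K → Network K → ℝ := fun H H' => if |f H' - f H| ≤ C then f H' - f H else 0
    with hΔ
  have hΔC : ∀ H H', |Δ H H'| ≤ C := fun H H' => by
    simp only [hΔ]
    split_ifs with h
    · exact h
    · simpa using hC
  have hD : ∀ H, HasSum (fun H' => stepProb π κ m G₀ H H' * Δ H H') (drift π κ m G₀ f H) := by
    intro H
    have h1 := hasSum_stepProb_mul (π := π) (κ := κ) (m := m) (G₀ := G₀) (G := H) (Δ H)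
    have h2 : (expectedStep π κ m G₀ H fun b t => Δ H (H.attach b t)) = drift π κ m G₀ f H := by
      unfold drift
      congr 1
      funext b t
      exact if_pos (hf H b t)
    rwa [h2] at h1
  have hDC : ∀ H, |drift π κ m G₀ f H| ≤ C := fun H =>
    (abs_expectedStep_le hπ hκ (hf H)).trans (expectedStep_const_le hπ hπs hκ hC)
  have hlim := ae_tendsto_average_step_sub_mean (P := P) (X := G) (p := stepProb π κ m G₀)
    (D := drift π κ m G₀ f) hG.measurable (fun H H' => stepProb_nonneg hπ hκ H') hG.step hΔC hD hDC
  filter_upwards [hlim, hG.ae_exists_attach] with ω h1 h2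
  refine tendsto_div_sub_average (x := fun n => f (G n ω)) (h1.congr fun n => ?_)
  congr 1
  refine Finset.sum_congr rfl fun i _ => ?_
  obtain ⟨b, t, hbt⟩ := h2 i
  have h3 : |f (G (i + 1) ω) - f (G i ω)| ≤ C := by
    rw [← hbt]
    exact hf _ b t
  simp only [hΔ, if_pos h3]

theorem IsNetworkProcess.ae_tendsto_vertexSum_sub_drift [IsProbabilityMeasure P]
    (hπ : ∀ a, 0 < π a) (hπs : ∑ a, π a = 1) (hκ : ∀ a b, 0 < κ a b) (hm : ∀ a, 1 ≤ m a)
    (hG : IsNetworkProcess P π κ m G₀ G) {g : Fin K → ℕ → ℝ}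
    (hg : ∀ c d x, |g c (d + x) - g c d| ≤ (x : ℝ)) (hgm : ∀ b, |g b (m b)| ≤ m b) :
    ∀ᵐ ω ∂P, Tendsto (fun n : ℕ => vertexSum G₀ (G n ω) g / n -
      (∑ i ∈ Finset.range n, drift π κ m G₀ (fun H => vertexSum G₀ H g) (G i ω)) / n)
      atTop (𝓝 0) := by
  refine hG.ae_tendsto_sub_drift hπ hπs hκ (f := fun H => vertexSum G₀ H g)
    (C := 2 * ∑ b, (m b : ℝ)) (mul_nonneg two_pos.le (Finset.sum_nonneg fun b _ => Nat.cast_nonneg _))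
    fun H b t => ?_
  -- The new vertex has at least one edge, whose target lies in `H`.
  have hH : 0 < H.size := (t ⟨0, hm b⟩).pos
  refine (abs_vertexSum_attach_sub_le hH b t hg (hgm b)).trans ?_
  have := Finset.single_le_sum (f := fun b => (m b : ℝ)) (fun b _ => Nat.cast_nonneg _)
    (Finset.mem_univ b)
  linarith

theorem abs_boole_sub_boole_le {p q : Prop} [Decidable p] [Decidable q] {x : ℕ}
    (h : x = 0 → (p ↔ q)) :
    |(if p then (1 : ℝ) else 0) - if q then 1 else 0| ≤ x := by
  rcases Nat.eq_zero_or_pos x with rfl | hx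
  · simp [h rfl]
  · have : (1 : ℝ) ≤ x := by exact_mod_cast hx
    split_ifs <;> simp <;> linarith

theorem abs_boole_le {p : Prop} [Decidable p] {x : ℕ} (h : 1 ≤ x) :
    |if p then (1 : ℝ) else 0| ≤ x := by
  have : (1 : ℝ) ≤ x := by exact_mod_cast h
  split_ifs
  · simpa using this
  · simp

end Path

/-! ### Limits along a single path. -/

section Growth

variable {K : ℕ} {π : Fin K → ℝ} {κ : Fin K → Fin K → ℝ} {m : Fin K → ℕ} {G₀ : Network K}
  {g : ℕ → Network K}

theorem hasPosDeg_of_attach (h0 : HasPosDeg G₀ (g 0))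
    (hg : ∀ n, ∃ (b : Fin K) (t : Fin (m b) → Fin (g n).size), (g n).attach b t = g (n + 1))
    (n : ℕ) : HasPosDeg G₀ (g n) := by
  induction n with
  | zero => exact h0
  | succ n ih =>
    obtain ⟨b, t, h⟩ := hg n
    exact h ▸ ih.attach b t

theorem size_of_attach
    (hg : ∀ n, ∃ (b : Fin K) (t : Fin (m b) → Fin (g n).size), (g n).attach b t = g (n + 1))
    (n : ℕ) : (g n).size = (g 0).size + n := by
  induction n with
  | zero => rfl
  | succ n ih =>
    obtain ⟨b, t, h⟩ := hg n
    rw [← h]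
    change (g n).size + 1 = _
    omega

theorem tendsto_size_div (hg : ∀ n, ∃ (b : Fin K) (t : Fin (m b) → Fin (g n).size),
    (g n).attach b t = g (n + 1)) :
    Tendsto (fun n : ℕ => ((g n).size : ℝ) / n) atTop (𝓝 1) := by
  have h := (tendsto_const_div_atTop_nhds_zero_nat ((g 0).size : ℝ)).add_const 1
  rw [zero_add] at h
  refine h.congr' ?_
  filter_upwards [eventually_ge_atTop 1] with n hn
  have : (n : ℝ) ≠ 0 := by positivity
  rw [size_of_attach hg n]
  push_cast
  field_simp

theorem attachRate_pos (hπ : ∀ a, 0 < π a) (hκ : ∀ a b, 0 < κ a b) (hm : ∀ a, 1 ≤ m a)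
    {y : Fin K → ℝ} (hy : ∀ a, 0 < y a) (a : Fin K) : 0 < attachRate π κ m y a :=
  Finset.sum_pos (fun b _ => div_pos (mul_pos (mul_pos (by exact_mod_cast hm b) (hπ b)) (hκ a b))
    (weighted_sum_pos hκ hy b)) ⟨a, Finset.mem_univ a⟩

/-- By homogeneity of degree -1, `n` times the rate at `Y n` is the rate at `Y n / n`, which tends
to the rate at `2η`; this is where the factor 1/2 of `φ / 2` arises. -/
theorem tendsto_mul_attachRate (hκ : ∀ a b, 0 < κ a b) {η : Fin K → ℝ} (hη : ∀ a, 0 < η a)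
    {Y : ℕ → Fin K → ℝ} (hY : ∀ a, Tendsto (fun n : ℕ => Y n a / n) atTop (𝓝 (2 * η a)))
    (a : Fin K) :
    Tendsto (fun n : ℕ => n * attachRate π κ m (Y n) a) atTop (𝓝 (attachRate π κ m η a / 2)) := by
  have hopen : IsOpen {y : Fin K → ℝ | ∀ i, 0 < y i} := by
    have : {y : Fin K → ℝ | ∀ i, 0 < y i} = ⋂ i, {y | 0 < y i} := by
      ext
      simp
    rw [this]
    exact isOpen_iInter_of_finite fun i => isOpen_lt continuous_const (continuous_apply i)
  have hc := ((attachRate_continuousOn (π := π) (m := m) hκ).continuousAt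
    (hopen.mem_nhds (fun i => mul_pos two_pos (hη i) : (fun i => 2 * η i) ∈ _))).tendsto.comp
    (tendsto_pi_nhds.2 hY)
  have h1 := tendsto_pi_nhds.1 hc a
  have h2 : attachRate π κ m (fun i => 2 * η i) a = attachRate π κ m η a / 2 := by
    have := attachRate_div (π := π) (κ := κ) (m := m) (1 / 2) η a
    have e : (fun i => η i / (1 / 2)) = fun i => 2 * η i := by
      funext i
      ring
    rw [e] at this
    rw [this]
    ring
  rw [h2] at h1
  exact h1.congr fun n => attachRate_div _ _ _

theorem tendsto_degCount_error (hκ : ∀ a b, 0 < κ a b) {η : Fin K → ℝ} (hη : ∀ a, 0 < η a)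
    {Y : ℕ → Fin K → ℝ} (hY : ∀ a, Tendsto (fun n : ℕ => Y n a / n) atTop (𝓝 (2 * η a)))
    {s : ℕ → ℝ} (hs : Tendsto (fun n : ℕ => s n / n) atTop (𝓝 1)) (c : Fin K → ℝ) :
    Tendsto (fun n : ℕ => ∑ b, π b * ((m b : ℝ) ^ 2 * (s n *
      (c b / ∑ l, Y n l * κ l b) ^ 2))) atTop (𝓝 0) := by
  have h : ∀ b, Tendsto (fun n : ℕ => s n * (c b / ∑ l, Y n l * κ l b) ^ 2) atTop (𝓝 0) := by
    intro b
    have h1 : Tendsto (fun n : ℕ => ∑ l, Y n l / n * κ l b) atTop (𝓝 (∑ l, 2 * η l * κ l b)) :=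
      tendsto_finsetSum _ fun l _ => (hY l).mul_const _
    have h2 : ∑ l, 2 * η l * κ l b ≠ 0 :=
      (weighted_sum_pos hκ (y := fun l => 2 * η l) (fun l => mul_pos two_pos (hη l)) b).ne'
    have h3 := (hs.mul (((tendsto_const_nhds (x := c b)).div h1 h2).pow 2)).mul
      (tendsto_one_div_atTop_nhds_zero_nat (𝕜 := ℝ))
    rw [mul_zero] at h3
    refine h3.congr' ?_
    filter_upwards [eventually_ge_atTop 1] with n hn
    have hn0 : (n : ℝ) ≠ 0 := by positivity
    have h4 : ∑ l, Y n l / n * κ l b = (∑ l, Y n l * κ l b) / n := by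
      rw [Finset.sum_div]
      exact Finset.sum_congr rfl fun l _ => by ring
    rw [Pi.div_apply, h4, div_div_eq_mul_div]
    simp only [div_pow, mul_pow]
    field_simp
  have h5 : Tendsto (fun n : ℕ => ∑ b, π b * ((m b : ℝ) ^ 2 * (s n *
      (c b / ∑ l, Y n l * κ l b) ^ 2))) atTop (𝓝 (∑ b, π b * ((m b : ℝ) ^ 2 * 0))) :=
    tendsto_finsetSum _ fun b _ => ((h b).const_mul _).const_mul _
  simpa using h5

/-- The asymptotic proportion of vertices that have attribute `a` and degree `k`. -/
noncomputable def limitShare (p φ : ℝ) (r k : ℕ) : ℝ :=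
  if k < r then 0 else p * limitPMF φ r k

theorem limitShare_zero (p φ : ℝ) {r : ℕ} (hr : 1 ≤ r) : limitShare p φ r 0 = 0 :=
  if_pos hr

theorem limitShare_succ (p : ℝ) {φ : ℝ} (hφ : 0 < φ) {r : ℕ} (hr : 1 ≤ r) (k : ℕ) :
    limitShare p φ r (k + 1) = ((if r = k + 1 then p else 0) + φ / 2 * (k * limitShare p φ r k)) /
      (1 + φ / 2 * ((k + 1 : ℕ) : ℝ)) := by
  unfold limitShare
  rcases lt_trichotomy (k + 1) r with h | h | h
  · rw [if_pos h, if_neg (by omega : ¬r = k + 1), if_pos (by omega)]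
    simp
  · subst h
    rw [if_neg (lt_irrefl _), if_pos rfl, if_pos (by omega), limitPMF_self hφ hr]
    ring
  · rw [if_neg (by omega), if_neg (by omega), if_neg (by omega), limitPMF_succ hφ (by omega)]
    ring

theorem tendsto_totalDeg_div
    (hπ : ∀ a, 0 < π a) (hκ : ∀ a b, 0 < κ a b) (hm : ∀ a, 1 ≤ m a)
    {η : Fin K → ℝ} (hη : IsPotentialMinimizer π κ m η) (h0 : HasPosDeg G₀ (g 0))
    (hg : ∀ n, ∃ (b : Fin K) (t : Fin (m b) → Fin (g n).size), (g n).attach b t = g (n + 1))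
    (hY : ∀ a, Tendsto (fun n : ℕ => totalDeg G₀ (g n) a / n -
      (∑ i ∈ Finset.range n, drift π κ m G₀ (fun H => totalDeg G₀ H a) (g i)) / n) atTop (𝓝 0))
    (a : Fin K) : Tendsto (fun n : ℕ => totalDeg G₀ (g n) a / n) atTop (𝓝 (2 * η a)) := by
  refine tendsto_of_degreeDrift hπ hκ hm hη (Y := fun n => totalDeg G₀ (g n))
    (fun n a => totalDeg_nonneg _ _ _) (fun a => (hY a).congr fun n => ?_) a
  simp only [drift_totalDeg hκ (hasPosDeg_of_attach h0 hg _)]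

theorem tendsto_attrCount_div (hκ : ∀ a b, 0 < κ a b) (h0 : HasPosDeg G₀ (g 0))
    (hg : ∀ n, ∃ (b : Fin K) (t : Fin (m b) → Fin (g n).size), (g n).attach b t = g (n + 1))
    (a : Fin K)
    (hN : Tendsto (fun n : ℕ => attrCount G₀ (g n) a / n -
      (∑ i ∈ Finset.range n, drift π κ m G₀ (fun H => attrCount G₀ H a) (g i)) / n) atTop (𝓝 0)) :
    Tendsto (fun n : ℕ => attrCount G₀ (g n) a / n) atTop (𝓝 (π a)) := by
  have h := tendsto_of_linear_recursion (c := 0) (b := π a) le_rfl hN ?_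
  · simpa using h
  · simp only [drift_attrCount hκ (hasPosDeg_of_attach h0 hg _), zero_mul, add_zero]
    exact tendsto_const_nhds

/-- Degree `k` is fed only by degree `k - 1` and births, so the rate equations can be solved by
induction on `k`, each through `tendsto_of_linear_recursion` with `c = φ / 2 * k`. -/
theorem tendsto_degCount_div
    (hπ : ∀ a, 0 < π a) (hκ : ∀ a b, 0 < κ a b) (hm : ∀ a, 1 ≤ m a)
    {η : Fin K → ℝ} (hη : IsPotentialMinimizer π κ m η) (h0 : HasPosDeg G₀ (g 0))
    (hg : ∀ n, ∃ (b : Fin K) (t : Fin (m b) → Fin (g n).size), (g n).attach b t = g (n + 1))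
    (hY : ∀ a, Tendsto (fun n : ℕ => totalDeg G₀ (g n) a / n) atTop (𝓝 (2 * η a)))
    (a : Fin K)
    (hN : ∀ k, Tendsto (fun n : ℕ => degCount G₀ (g n) a k / n -
      (∑ i ∈ Finset.range n, drift π κ m G₀ (fun H => degCount G₀ H a k) (g i)) / n) atTop (𝓝 0))
    (k : ℕ) :
    Tendsto (fun n : ℕ => degCount G₀ (g n) a k / n) atTop
      (𝓝 (limitShare (π a) (attachRate π κ m η a) (m a) k)) := by
  set φ := attachRate π κ m η a with hφdef
  have hφ : 0 < φ := attachRate_pos hπ hκ hm hη.1 a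
  have hrate := tendsto_mul_attachRate (π := π) (m := m) hκ hη.1 hY a
  have hsize := tendsto_size_div hg
  have hrec : ∀ k q, Tendsto (fun n : ℕ => predDeg G₀ (g n) a k / n) atTop (𝓝 q) →
      Tendsto (fun n : ℕ => degCount G₀ (g n) a k / n) atTop
        (𝓝 (((if m a = k then π a else 0) + φ / 2 * q) / (1 + φ / 2 * k))) := by
    intro k q hq
    refine tendsto_of_linear_recursion (by positivity) (hN k) ?_
    have herr : Tendsto (fun n : ℕ => drift π κ m G₀ (fun H => degCount G₀ H a k) (g n) -
        ((if m a = k then π a else 0) + attachRate π κ m (totalDeg G₀ (g n)) a *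
        (predDeg G₀ (g n) a k - k * degCount G₀ (g n) a k))) atTop (𝓝 0) :=
      squeeze_zero_norm (fun n => abs_drift_degCount_sub_le hπ hκ (hasPosDeg_of_attach h0 hg n) a k)
        (tendsto_degCount_error hκ hη.1 hY hsize _)
    -- Convergence of this count is not yet known; boundedness is enough to replace `n` times the
    -- rate by its limit in the outflow term.
    have hx : ∀ᶠ n : ℕ in atTop, |k * (degCount G₀ (g n) a k / n)| ≤ k * 2 := by
      filter_upwards [hsize.eventually_le_const (by norm_num : (1 : ℝ) < 2)] with n hn
      have h1 : 0 ≤ degCount G₀ (g n) a k / n :=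
        div_nonneg (degCount_nonneg _ _) (Nat.cast_nonneg _)
      rw [abs_of_nonneg (by positivity)]
      refine mul_le_mul_of_nonneg_left (le_trans ?_ hn) (Nat.cast_nonneg _)
      exact div_le_div_of_nonneg_right (degCount_le _ _) (Nat.cast_nonneg _)
    have h2 := tendsto_mul_zero_of_bounded hx (tendsto_sub_nhds_zero_iff.2 hrate)
    have h3 := ((herr.add_const (if m a = k then π a else 0)).add (hrate.mul hq)).sub h2
    rw [zero_add, sub_zero] at h3
    refine h3.congr' ?_
    filter_upwards [eventually_ge_atTop 1] with n hn
    have hn0 : (n : ℝ) ≠ 0 := by positivity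
    field_simp
    ring
  induction k with
  | zero =>
    have h := hrec 0 0 (by simp [predDeg_zero])
    rw [limitShare_zero _ _ (hm a)]
    simpa [(Nat.one_le_iff_ne_zero.1 (hm a))] using h
  | succ k ih =>
    rw [limitShare_succ _ hφ (hm a)]
    refine hrec (k + 1) _ ((ih.const_mul (k : ℝ)).congr fun n => ?_)
    rw [predDeg_succ]
    ring

end Growth

/-- Almost surely, the empirical degree distributions converge. -/
theorem IsNetworkProcess.ae_tendsto_degFraction {K : ℕ} {Ω : Type*} [MeasurableSpace Ω]
    {P : Measure Ω} [IsProbabilityMeasure P] {π : Fin K → ℝ} {κ : Fin K → Fin K → ℝ}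
    {m : Fin K → ℕ} (hπ : ∀ a, 0 < π a) (hπs : ∑ a, π a = 1) (hκ : ∀ a b, 0 < κ a b)
    (hm : ∀ a, 1 ≤ m a) {η : Fin K → ℝ} (hη : IsPotentialMinimizer π κ m η) {G₀ : Network K}
    (h₀ : G₀.Connected) {G : ℕ → Ω → Network K} (hG : IsNetworkProcess P π κ m G₀ G)
    (a : Fin K) :
    ∀ᵐ ω ∂P, ∀ k, m a ≤ k → Tendsto (fun n => degFraction G₀ (G n ω) a k) atTop
      (𝓝 (limitPMF (attachRate π κ m η a) (m a) k)) := by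
  have hY : ∀ᵐ ω ∂P, ∀ c, Tendsto (fun n : ℕ => totalDeg G₀ (G n ω) c / n -
      (∑ i ∈ Finset.range n, drift π κ m G₀ (fun H => totalDeg G₀ H c) (G i ω)) / n)
      atTop (𝓝 0) := by
    rw [ae_all_iff]
    intro c
    refine hG.ae_tendsto_vertexSum_sub_drift hπ hπs hκ hm (fun b d x => ?_) fun b => ?_
    · split_ifs <;> simp
    · split_ifs <;> simp
  have hA := hG.ae_tendsto_vertexSum_sub_drift hπ hπs hκ hm
    (g := fun c _ => if c = a then 1 else 0)
    (fun b d x => abs_boole_sub_boole_le fun _ => Iff.rfl) fun b => abs_boole_le (hm b)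
  have hN : ∀ᵐ ω ∂P, ∀ k, Tendsto (fun n : ℕ => degCount G₀ (G n ω) a k / n -
      (∑ i ∈ Finset.range n, drift π κ m G₀ (fun H => degCount G₀ H a k) (G i ω)) / n)
      atTop (𝓝 0) := by
    rw [ae_all_iff]
    intro k
    refine hG.ae_tendsto_vertexSum_sub_drift hπ hπs hκ hm (fun b d x => ?_)
      fun b => abs_boole_le (hm b)
    exact abs_boole_sub_boole_le fun hx => by simp [hx]
  filter_upwards [hY, hA, hN, hG.ae_exists_attach, hG.initial] with ω hY hA hN hg h0 k hk
  have h0' : HasPosDeg G₀ (G 0 ω) := h0 ▸ h₀.hasPosDeg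
  have h1 := tendsto_totalDeg_div (g := fun n => G n ω) hπ hκ hm hη h0' hg hY
  have h2 := tendsto_degCount_div (g := fun n => G n ω) hπ hκ hm hη h0' hg h1 a hN k
  have h3 := tendsto_attrCount_div (g := fun n => G n ω) hκ h0' hg a hA
  -- Degree and attribute counts are both normalised by `n`; in the quotient of their limits the
  -- factor `π a` cancels.
  have h4 := h2.div h3 (hπ a).ne'
  rw [limitShare, if_neg (by omega), mul_div_cancel_left₀ _ (hπ a).ne'] at h4
  refine h4.congr' ?_
  filter_upwards [eventually_ge_atTop 1] with n hn
  have hn0 : (n : ℝ) ≠ 0 := by positivity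
  rw [degFraction_eq]
  exact div_div_div_cancel_right₀ hn0 _ _

end AttributedPA

theorem theorem4p3 {K : ℕ} (π : Fin K → ℝ) (κ : Fin K → Fin K → ℝ) (m : Fin K → ℕ)
    (hπ_pos : ∀ a, 0 < π a) (hπ_sum : ∑ a, π a = 1) (hκ : ∀ a b, 0 < κ a b) (hm : ∀ a, 1 ≤ m a) :
    ∃ η : Fin K → ℝ,
      AttributedPA.IsPotentialMinimizer π κ m η ∧
      (∀ η', AttributedPA.IsPotentialMinimizer π κ m η' → η' = η) ∧
      ∀ a : Fin K,
        0 < AttributedPA.phi π κ m η a ∧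
        (∀ {Ω : Type*} [MeasurableSpace Ω] (P : Measure Ω) [IsProbabilityMeasure P]
            (G₀ : AttributedPA.Network K) (_ : G₀.Connected) (G : ℕ → Ω → AttributedPA.Network K),
          AttributedPA.IsNetworkProcess P π κ m G₀ G →
          ∀ᵐ ω ∂P, ∀ k : ℕ, m a ≤ k →
            Tendsto (fun n => AttributedPA.Network.degFraction G₀ (G n ω) a k) atTop
              (𝓝 (AttributedPA.limitPMF (AttributedPA.phi π κ m η a) (m a) k))) ∧
        HasSum (fun j : ℕ => AttributedPA.limitPMF (AttributedPA.phi π κ m η a) (m a) (m a + j)) 1 ∧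
        (fun k : ℕ => AttributedPA.limitPMF (AttributedPA.phi π κ m η a) (m a) k) ~[atTop]
          fun k : ℕ =>
            2 / AttributedPA.phi π κ m η a *
              (Real.Gamma (m a + 2 / AttributedPA.phi π κ m η a) / Real.Gamma (m a)) *
              (k : ℝ) ^ (-(1 + 2 / AttributedPA.phi π κ m η a)) := by
  obtain ⟨η, hη⟩ := AttributedPA.exists_isPotentialMinimizer hπ_pos hκ hm
  refine ⟨η, hη, fun η' hη' => hη.unique hπ_pos hκ hm hη', fun a => ?_⟩
  have hφ := AttributedPA.attachRate_pos hπ_pos hκ hm hη.1 a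
  rw [AttributedPA.phi_eq_attachRate]
  exact ⟨hφ, fun P _ G₀ h₀ G hG => hG.ae_tendsto_degFraction hπ_pos hπ_sum hκ hm hη h₀ a,
    AttributedPA.hasSum_limitPMF hφ (hm a), AttributedPA.limitPMF_isEquivalent hφ (hm a)⟩
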